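/- \textbf{Setting.} Forces in $\mathbb{RP}^2$ are exterior $2$-forms on $\mathbb R^3$. For $p=(a_1,a_2,a_3)$ put $dp=\sum a_i\,dx_i$; a nonzero force can be written $dp\wedge dq$, and its line of force is the projective line through $p$ and $q$ (the zero force acts along every line). A framework $G(P)$ is a finite simple graph $G$ on vertices $v_1,\dots,v_n$ with points $P=(p_1,\dots,p_n)$ in $\mathbb{RP}^2$. It is \emph{in general position} if $G$ is connected, all its degrees are at least $3$, and, for every simple cycle of $G$ with $k\le n-1$ vertices, the lines through its edges have exactly $k(k-1)/2$ distinct pairwise intersection points. A \emph{tensegrity} on $G(P)$ is a family of forces $F_{i,j}$, acting along the line $p_ip_j$ for every edge $v_iv_j$ and zero otherwise, with $F_{i,j}+F_{j,i}=0$ and $\sum_j F_{i,j}=0$ for all $i$. Forces $F_1,\dots,F_s$ form a \emph{non-parallelizable system} if (a) $\sum a_iF_i=0$ with $a_i\in\{0,1\}$ implies $a_1=\dots=a_s$, and (b) the $2^{s-1}-1$ lines of force of $F_1+\sum_{i\ge2}a_iF_i$, $(a_2,\dots,a_s)\in\{0,1\}^{s-1}\setminus\{(1,\dots,1)\}$,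 are distinct. A tensegrity is \emph{non-parallelizable} if at every vertex the forces on the adjacent edges form a non-parallelizable system. A \emph{resolution scheme} $(T,\mathcal L)_p$ is a finite tree $T$ with all degrees $1$ or $3$ and, for each edge $e$ of $T$, a line $\mathcal L(e)$ through $p$. A \emph{leaf} is an edge with an end of degree $1$; other edges are interior. An \emph{equilibrium force-load} on it assigns to every edge $v_iv_j$ forces $F_{i,j}=-F_{j,i}$ acting along $\mathcal L(v_iv_j)$ whose sum $\sum_jF_{i,j}$ vanishes at every vertex $v_i$ of degree $3$. The scheme is \emph{weakly generic} if adjacent edges carry distinct lines (then a nonzero equilibrium force-load exists and is unique up to a factor), and \emph{strongly generic} if, moreover, for a nonzero equilibrium force-load the forces $F_{i,j}$ at the leaves $v_iv_j$ ($v_j$ being the end of degree $1$) form a non-parallelizable system. An \emph{$H\Phi$-surgery} on a strongly generic scheme replaces, for distinct vertices $v_1,\dots,v_6$, the edges $v_1v_2,v_1v_3,v_1v_4,v_2v_5,v_2v_6$ of $T$ by $v_1'v_2',v_1'v_3,v_1'v_5,v_2'v_4,v_2'v_6$, where $v_1',v_2'$ are new vertices replacing $v_1,v_2$; the edges at $v_3,v_4,v_5,v_6$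 and all other edges keep their lines, and $v_1'v_2'$ gets the line of force of $F_{1,3}+F_{2,5}$, where $F$ is a nonzero equilibrium force-load. Two schemes are \emph{equivalent} if a finite sequence of $H\Phi$-surgeries takes one to the other. A \emph{quantization} of $G(P)$ consists of a tree $T_i$ with all degrees $1$ or $3$ for each vertex $v_i$, whose leaves correspond bijectively to the edges of $G$ at $v_i$, and a map $\mathcal L$ assigning lines to the edges of the \emph{resolution graph} (obtained from the disjoint union of the $T_i$ by gluing, for each edge of $G$, the two leaves corresponding to it), such that $\mathcal L(e)=p_ip_j$ if $e$ comes from the edge $v_iv_j$ of $G$, and $p_i\in\mathcal L(e)$ if $e$ is an interior edge of $T_i$. It is \emph{generic} if, for every $i$, the resolution scheme $(T_i,\mathcal L|_{T_i})_{p_i}$ is strongly generic. For a generic quantization and edges $v_iv_j$, $v_iv_k$ with $j\neq k$, the \emph{associated framing} $\ell_{jik}$ is the line carried by the third edge at $v$, in a scheme equivalent to $(T_i,\mathcal L|_{T_i})_{p_i}$ in which the leaves for $v_iv_j$ and $v_iv_k$ have a common vertex $v$. A simple cycle of $G$ with consecutive points $q_1,\dots,q_s$ that misses some vertex of $G$ thus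 becomes a \emph{framed cycle}, with framing line $\ell_i\ni q_i$ associated to the two cycle edges at $q_i$ (indices mod $s$). For a line $\ell$ through none of the $q_i$, the \emph{monodromy} at $\ell_i$ is the composition once around the cycle of the maps $\ell_t\to\ell_{t+1}$, $x\mapsto \ell_{t+1}\cap\big((q_tq_{t+1}\cap\ell),x\big)$, starting at $\ell_i$; it is \emph{trivial} if it is the identity of $\ell_i$. The quantization is \emph{consistent} if, for every simple cycle of $G$ missing some vertex of $G$, the framed cycle has trivial monodromy (for all such $\ell$ and all $i$). \textbf{Theorem.} A framework $G(P)$ in general position admits a non-parallelizable tensegrity if and only if it has a consistent generic quantization. -/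

import Mathlib

open scoped LinearAlgebra.Projectivization

noncomputable section

namespace Tensegrity

/-! ### The real projective plane and forces -/

/-- Points of the real projective plane. -/
abbrev Point : Type := ℙ ℝ (Fin 3 → ℝ)

/-- Lines of the real projective plane, i.e. points of `Gr(2,3)`. -/
abbrev ProjLine : Type := {W : Submodule ℝ (Fin 3 → ℝ) // Module.finrank ℝ W = 2}

/-- The line `pq` through two points, as a linear subspace of `ℝ³`
(it is a projective line exactly when the points are distinct). -/
def join (p q : Point) : Submodule ℝ (Fin 3 → ℝ) := p.submodule ⊔ q.submodule

/-- Exterior 2-forms on `ℝ³`; all of them are decomposable, so these are exactly the forces. -/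
abbrev TwoForm : Type := (Fin 3 → ℝ) [⋀^Fin 2]→ₗ[ℝ] ℝ

/-- The linear map `x ↦ (dp(x), dq(x))`, where `dp = a₁dx₁ + a₂dx₂ + a₃dx₃` for `p = (a₁,a₂,a₃)`. -/
def dPair (p q : Fin 3 → ℝ) : (Fin 3 → ℝ) →ₗ[ℝ] (Fin 2 → ℝ) :=
  Matrix.mulVecLin (Matrix.of ![p, q])

/-- The 2-form `dp ∧ dq`, i.e. `(x, y) ↦ dp(x) dq(y) - dp(y) dq(x)`. -/
def dWedge (p q : Fin 3 → ℝ) : TwoForm :=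
  (Matrix.detRowAlternating (R := ℝ) (n := Fin 2)).compLinearMap (dPair p q)

theorem dWedge_apply (p q : Fin 3 → ℝ) (x : Fin 2 → Fin 3 → ℝ) :
    dWedge p q x = (p ⬝ᵥ x 0) * (q ⬝ᵥ x 1) - (p ⬝ᵥ x 1) * (q ⬝ᵥ x 0) := by
  have h : dWedge p q x = Matrix.det (Matrix.of fun i => dPair p q (x i)) := rfl
  rw [h, Matrix.det_fin_two]
  simp [dPair]
  ring

/-- `W` is the line of force of the nonzero force `F`: one has `F = dp ∧ dq` where `p`, `q` span
`W`. -/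
def IsLineOfForce (F : TwoForm) (W : Submodule ℝ (Fin 3 → ℝ)) : Prop :=
  F ≠ 0 ∧ ∃ p q : Fin 3 → ℝ, F = dWedge p q ∧ Submodule.span ℝ {p, q} = W

/-- The force `F` acts along the line `W` (the zero force acts along every line). -/
def ActsAlong (F : TwoForm) (W : Submodule ℝ (Fin 3 → ℝ)) : Prop :=
  F = 0 ∨ IsLineOfForce F W

/-- The two conditions of non-parallelizability for a finite system of forces `F₁, …, Fₛ`.
A vector `(a₁, …, aₛ) ∈ {0,1}ˢ` is written as the set `A` of all `i` with `aᵢ = 1`. -/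
structure NonParallelizableSystem {ι : Type*} [Fintype ι] (F : ι → TwoForm) : Prop where
  /-- `∑ aᵢ Fᵢ = 0` implies `a₁ = ⋯ = aₛ`. -/
  sum_eq_zero : ∀ A : Finset ι, ∑ i ∈ A, F i = 0 → A = ∅ ∨ A = Finset.univ
  /-- The lines of force of the sums containing a chosen term, but not all of the terms, are
  pairwise distinct. -/
  lines_distinct : ∀ (i₁ : ι) (A B : Finset ι), i₁ ∈ A → i₁ ∈ B →
    A ≠ Finset.univ → B ≠ Finset.univ → A ≠ B →
    ∀ ℓ m : Submodule ℝ (Fin 3 → ℝ),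
      IsLineOfForce (∑ i ∈ A, F i) ℓ → IsLineOfForce (∑ i ∈ B, F i) m → ℓ ≠ m

/-! ### Frameworks and tensegrities

A framework `G(P)` is given by a simple graph `G` on `V` and a map `P : V → Point`. -/

section Framework

variable {V : Type*} (G : SimpleGraph V) (P : V → Point)

/-- Force-loads on the framework `G(P)`; `F i j` is the force `F_{i,j}`. -/
structure IsForceLoad (F : V → V → TwoForm) : Prop where
  along : ∀ i j, G.Adj i j → ActsAlong (F i j) (join (P i) (P j))
  stress : ∀ i j, F i j + F j i = 0
  zero : ∀ i j, ¬ G.Adj i j → F i j = 0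

/-- Equilibrium force-loads: `(G(P), F)` is a tensegrity. -/
structure IsTensegrity [Fintype V] (F : V → V → TwoForm) : Prop extends IsForceLoad G P F where
  equilibrium : ∀ i, ∑ j, F i j = 0

/-- The tensegrity `(G(P), F)` is non-parallelizable (at every vertex). -/
structure IsNonParallelizableTensegrity [Fintype V] [DecidableRel G.Adj]
    (F : V → V → TwoForm) : Prop extends IsTensegrity G P F where
  nonParallelizable : ∀ i, NonParallelizableSystem (fun j : G.neighborSet i => F i j)

/-- `q` lists, in cyclic order, the vertices of a simple cycle of `G` with `k` vertices. -/
structure IsSimpleCycle {k : ℕ} (q : ZMod k → V) : Prop where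
  three_le : 3 ≤ k
  injective : Function.Injective q
  adj : ∀ t, G.Adj (q t) (q (t + 1))

/-- A cycle with consecutive vertices `p t` is in general position: the pairwise intersections of
its `k` edge lines form a set of exactly `k(k-1)/2` points. -/
def CycleInGeneralPosition {k : ℕ} (p : ZMod k → Point) : Prop :=
  {x : Point | ∃ s t : ZMod k, s ≠ t ∧ x.submodule ≤ join (p s) (p (s + 1)) ∧
    x.submodule ≤ join (p t) (p (t + 1))}.encard = (k.choose 2 : ℕ)

/-- The framework `G(P)` is in general position: `G` is connected with all degrees at least `3`,
and all simple cycles that miss some vertex are in general position. -/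
structure InGeneralPosition [Fintype V] [DecidableRel G.Adj] : Prop where
  connected : G.Connected
  three_le_degree : ∀ v, 3 ≤ G.degree v
  cycles : ∀ (k : ℕ) (q : ZMod k → V), IsSimpleCycle G q → k < Fintype.card V →
    CycleInGeneralPosition (fun t => P (q t))

end Framework

/-! ### Shift operators and monodromies of framed cycles -/

/-- The shift operator `x ↦ m ∩ ((e ∩ ℓ), x)`, for the edge line `e` and the target line `m`. -/
def shift (ℓ e m x : Submodule ℝ (Fin 3 → ℝ)) : Submodule ℝ (Fin 3 → ℝ) :=
  m ⊓ ((e ⊓ ℓ) ⊔ x)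

/-- The shift operator along the path `p i, p (i+1), …, p (i+s)` of the framed cycle
`((p t)ₜ, (L t)ₜ)`. -/
def shiftAlong {k : ℕ} (p : ZMod k → Point) (L : ZMod k → ProjLine) (ℓ : ProjLine) (i : ZMod k) :
    ℕ → Submodule ℝ (Fin 3 → ℝ) → Submodule ℝ (Fin 3 → ℝ)
  | 0, x => x
  | s + 1, x =>
      shift ℓ.1 (join (p (i + s)) (p (i + s + 1))) (L (i + s + 1)).1 (shiftAlong p L ℓ i s x)

/-- The monodromy at the framing line `L i`: the shift operator once around the cycle. -/
def monodromy {k : ℕ} (p : ZMod k → Point) (L : ZMod k → ProjLine) (ℓ : ProjLine) (i : ZMod k)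
    (x : Submodule ℝ (Fin 3 → ℝ)) : Submodule ℝ (Fin 3 → ℝ) :=
  shiftAlong p L ℓ i k x

/-- The monodromies of the framed cycle are trivial: for every line `ℓ` that contains no vertex of
the cycle and every `i`, the monodromy fixes every point of the framing line `L i`. -/
def TrivialMonodromy {k : ℕ} (p : ZMod k → Point) (L : ZMod k → ProjLine) : Prop :=
  ∀ ℓ : ProjLine, (∀ t, ¬ (p t).submodule ≤ ℓ.1) → ∀ (i : ZMod k) (x : Point),
    x.submodule ≤ (L i).1 → monodromy p L ℓ i x.submodule = x.submodule

/-! ### Resolution schemes -/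

/-- Unrooted full binary trees whose vertices of degree `1` are indexed by `E` and whose vertices
of degree `3` are indexed by `I`. -/
structure BinaryTree (E I : Type*) where
  graph : SimpleGraph (E ⊕ I)
  isTree : graph.IsTree
  degree_leaf : ∀ e, (graph.neighborSet (Sum.inl e)).encard = 1
  degree_inner : ∀ x, (graph.neighborSet (Sum.inr x)).encard = 3

/-- Resolution schemes `(T, L)_p` at the point `p`. -/
structure ResolutionScheme (E I : Type*) (p : Point) where
  tree : BinaryTree E I
  line : tree.graph.edgeSet → ProjLine
  mem : ∀ e, p.submodule ≤ (line e).1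

namespace ResolutionScheme

variable {E I : Type*} {p : Point} (S : ResolutionScheme E I p)

/-- Force-loads on a resolution scheme. -/
structure IsForceLoad (F : E ⊕ I → E ⊕ I → TwoForm) : Prop where
  along : ∀ a b (h : s(a, b) ∈ S.tree.graph.edgeSet),
    ActsAlong (F a b) (S.line ⟨s(a, b), h⟩).1
  stress : ∀ a b, F a b + F b a = 0
  zero : ∀ a b, ¬ S.tree.graph.Adj a b → F a b = 0

/-- Equilibrium force-loads: the forces sum to zero at all vertices of degree `3`. -/
structure IsEquilibrium [Fintype E] [Fintype I] (F : E ⊕ I → E ⊕ I → TwoForm) : Prop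
    extends S.IsForceLoad F where
  equilibrium : ∀ x : I, ∑ b, F (Sum.inr x) b = 0

/-- The force acting along the leaf ending at the vertex `e` of degree `1`: it is `F w e` for the
only neighbour `w` of `e` (all other terms are zero for a force-load). -/
def leafForce [Fintype E] [Fintype I] (F : E ⊕ I → E ⊕ I → TwoForm) (e : E) : TwoForm :=
  ∑ w, F w (Sum.inl e)

/-- Adjacent edges carry distinct lines. -/
def WeaklyGeneric : Prop :=
  ∀ a b c (h : s(a, b) ∈ S.tree.graph.edgeSet) (h' : s(b, c) ∈ S.tree.graph.edgeSet), a ≠ c →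
    S.line ⟨s(a, b), h⟩ ≠ S.line ⟨s(b, c), h'⟩

/-- Strong genericity. A weakly generic scheme has a nonzero equilibrium force-load, which is
unique up to a factor. -/
def StronglyGeneric [Fintype E] [Fintype I] : Prop :=
  S.WeaklyGeneric ∧ ∃ F, S.IsEquilibrium F ∧ F ≠ 0 ∧ NonParallelizableSystem (leafForce F)

/-- `S'` is obtained from `S` by the HΦ-surgery at the interior edge `v₁v₂` of the subgraph with
edges `v₁v₂, v₁v₃, v₁v₄, v₂v₅, v₂v₆`, which is replaced by the graph with edges
`v₁v₂, v₁v₃, v₁v₅, v₂v₄, v₂v₆`. (The two new vertices `v₁'`, `v₂'` are called `v₁`, `v₂` again.) -/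
structure IsSurgeryAt [Fintype E] [Fintype I] (S S' : ResolutionScheme E I p)
    (v₁ v₂ v₃ v₄ v₅ v₆ : E ⊕ I) : Prop where
  nodup : [v₁, v₂, v₃, v₄, v₅, v₆].Nodup
  adj₁₂ : S.tree.graph.Adj v₁ v₂
  adj₁₃ : S.tree.graph.Adj v₁ v₃
  adj₁₄ : S.tree.graph.Adj v₁ v₄
  adj₂₅ : S.tree.graph.Adj v₂ v₅
  adj₂₆ : S.tree.graph.Adj v₂ v₆
  edges : S'.tree.graph.edgeSet =
    (S.tree.graph.edgeSet \ {s(v₁, v₄), s(v₂, v₅)}) ∪ {s(v₁, v₅), s(v₂, v₄)}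
  line₁₅ : ∀ (h : s(v₂, v₅) ∈ S.tree.graph.edgeSet) (h' : s(v₁, v₅) ∈ S'.tree.graph.edgeSet),
    S'.line ⟨s(v₁, v₅), h'⟩ = S.line ⟨s(v₂, v₅), h⟩
  line₂₄ : ∀ (h : s(v₁, v₄) ∈ S.tree.graph.edgeSet) (h' : s(v₂, v₄) ∈ S'.tree.graph.edgeSet),
    S'.line ⟨s(v₂, v₄), h'⟩ = S.line ⟨s(v₁, v₄), h⟩
  line_other : ∀ (e : Sym2 (E ⊕ I)) (h : e ∈ S.tree.graph.edgeSet)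
    (h' : e ∈ S'.tree.graph.edgeSet), e ≠ s(v₁, v₂) → S'.line ⟨e, h'⟩ = S.line ⟨e, h⟩
  /-- The new line is the line of force of `F_{1,3} + F_{2,5}`, for a nonzero equilibrium
  force-load `F` of `S`. -/
  line₁₂ : ∃ F, S.IsEquilibrium F ∧ F ≠ 0 ∧ ∀ h' : s(v₁, v₂) ∈ S'.tree.graph.edgeSet,
    IsLineOfForce (F v₁ v₃ + F v₂ v₅) (S'.line ⟨s(v₁, v₂), h'⟩).1

/-- `S'` is obtained from the strongly generic scheme `S` by some HΦ-surgery. -/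
def IsSurgery [Fintype E] [Fintype I] (S S' : ResolutionScheme E I p) : Prop :=
  S.StronglyGeneric ∧ ∃ v₁ v₂ v₃ v₄ v₅ v₆, IsSurgeryAt S S' v₁ v₂ v₃ v₄ v₅ v₆

/-- Equivalence: a finite sequence of HΦ-surgeries takes `S` to `S'`. -/
def Equivalent [Fintype E] [Fintype I] (S S' : ResolutionScheme E I p) : Prop :=
  Relation.ReflTransGen IsSurgery S S'

/-- `ℓ` is the framing associated to the leaves `j` and `k`: in some scheme equivalent to `S`, the
leaves `j` and `k` have a common vertex `v`, and `ℓ` is the line of the third edge `vw` at `v`. -/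
def IsAssociatedFraming [Fintype E] [Fintype I] (j k : E) (ℓ : ProjLine) : Prop :=
  ∃ S' : ResolutionScheme E I p, S.Equivalent S' ∧ ∃ v w : E ⊕ I,
    S'.tree.graph.Adj (Sum.inl j) v ∧ S'.tree.graph.Adj (Sum.inl k) v ∧
    w ≠ Sum.inl j ∧ w ≠ Sum.inl k ∧
    ∃ h : s(v, w) ∈ S'.tree.graph.edgeSet, S'.line ⟨s(v, w), h⟩ = ℓ

end ResolutionScheme

/-! ### Quantizations -/

section Quantization

variable {V : Type*} {G : SimpleGraph V}

/-- The gluing relation on the edges of a family of trees `T i`, where the leaves of `T i` are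
indexed by the neighbours of `i`, i.e. by the edges of `G` at `i`: the leaf of `T i` with index `j`
is glued to the leaf of `T j` with index `i`. -/
inductive Glue {I : V → Type} (T : ∀ i, BinaryTree (G.neighborSet i) (I i)) :
    (Σ i, (T i).graph.edgeSet) → (Σ i, (T i).graph.edgeSet) → Prop
  | glue (i j : V) (h : G.Adj i j) (e : (T i).graph.edgeSet) (e' : (T j).graph.edgeSet)
      (he : Sum.inl ⟨j, h⟩ ∈ e.1) (he' : Sum.inl ⟨i, h.symm⟩ ∈ e'.1) : Glue T ⟨i, e⟩ ⟨j, e'⟩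

/-- The edge set of the resolution graph `G_T`: the edges of all trees `T i`, with the two leaves
corresponding to an edge of `G` glued to a single edge. -/
def ResolutionEdge {I : V → Type} (T : ∀ i, BinaryTree (G.neighborSet i) (I i)) : Type _ :=
  Quot (Glue T)

variable (G) in
/-- Quantizations of the framework `G(P)`. -/
structure Quantization (P : V → Point) where
  /-- The vertices of degree `3` of the resolution trees. -/
  inner : V → Type
  fintypeInner : ∀ i, Fintype (inner i)
  /-- The resolution trees. -/
  tree : ∀ i, BinaryTree (G.neighborSet i) (inner i)
  /-- The lines on the edges of the resolution graph. -/
  line : ResolutionEdge tree → ProjLine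
  leaf : ∀ i (e : (tree i).graph.edgeSet) (j : G.neighborSet i), Sum.inl j ∈ e.1 →
    (line (Quot.mk _ ⟨i, e⟩)).1 = join (P i) (P j)
  interior : ∀ i (e : (tree i).graph.edgeSet), (∀ j : G.neighborSet i, Sum.inl j ∉ e.1) →
    (P i).submodule ≤ (line (Quot.mk _ ⟨i, e⟩)).1

namespace Quantization

variable {P : V → Point} (Q : Quantization G P)

instance (i : V) : Fintype (Q.inner i) := Q.fintypeInner i

/-- The resolution scheme of the quantization at the vertex `i`. -/
def scheme (i : V) : ResolutionScheme (G.neighborSet i) (Q.inner i) (P i) where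
  tree := Q.tree i
  line e := Q.line (Quot.mk _ ⟨i, e⟩)
  mem e := by
    by_cases h : ∃ j : G.neighborSet i, Sum.inl j ∈ e.1
    · obtain ⟨j, hj⟩ := h
      rw [Q.leaf i e j hj]
      exact le_sup_left
    · exact Q.interior i e (fun j hj => h ⟨j, hj⟩)

variable [Fintype V] [DecidableRel G.Adj]

/-- All resolution schemes are strongly generic. -/
def Generic : Prop := ∀ i, (Q.scheme i).StronglyGeneric

/-- `L` is the framing of the framed cycle associated to `Q` and the simple cycle `q` of `G`. -/
def IsCycleFraming {k : ℕ} (q : ZMod k → V) (L : ZMod k → ProjLine) : Prop :=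
  ∀ t, ∃ (h : G.Adj (q t) (q (t - 1))) (h' : G.Adj (q t) (q (t + 1))),
    (Q.scheme (q t)).IsAssociatedFraming ⟨q (t - 1), h⟩ ⟨q (t + 1), h'⟩ (L t)

/-- Consistency at every simple cycle that does not contain all vertices. -/
def Consistent : Prop :=
  ∀ (k : ℕ) (q : ZMod k → V), IsSimpleCycle G q → k < Fintype.card V →
    ∃ L : ZMod k → ProjLine, Q.IsCycleFraming q L ∧ TrivialMonodromy (fun t => P (q t)) L

end Quantization

end Quantization

end Tensegrity

end

noncomputable section

namespace Tensegrity

/-! Identify a force `dp ∧ dq` with the functional `det(p, q, ·)` on ℝ³. Its line of force is the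
kernel, the forces along a fixed line form a one-dimensional space, and force equations become
linear equations between functionals.

Local part. An equilibrium force-load on a resolution tree is a flow: antisymmetric on darts, with
zero sum at inner vertices. It is determined by its leaf forces; its value on a dart `ab` is the sum
of the leaf forces beyond that dart. If the leaf forces are non-parallelizable, all these partial
sums are nonzero and adjacent edges carry distinct lines, so every tree becomes a strongly generic
scheme (`stronglyGeneric_scheme`). An HΦ-surgery reroutes two edge forces through the middle edge
and leaves the leaf forces unchanged. Hence the framing associated to leaves `j`, `k` is the kernel
of `f j + f k`, whatever scheme computes it (`IsAssociatedFraming.eq_ker`), and surgeries along a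
path do bring `j` and `k` together (`exists_isAssociatedFraming`).

Cycle part. Let `g` be an equation of ℓ and `φ t` the functional of the force on the edge `q t q
(t+1)`. The shift across that edge is induced by a projection of ℝ³ along the point where the edge
line meets ℓ, hence it preserves both `g` and `φ t`. If `φ (t+1) = r t • φ t` on the next framing
line, going once around fixes `g` and multiplies `φ` by the product of the `r t`. So trivial
monodromy forces this product to be `1` (`prod_eq_one`), and the case of all `r t` equal to `1`
gives trivial monodromy (`trivialMonodromy`).

Global part. A tensegrity supplies leaf forces at each vertex with all ratios `1`, hence a
consistent generic quantization. Conversely, the force-loads of a quantization are fixed only up to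
a factor at each vertex, and the two forces on an edge differ by a ratio `r i j`. Consistency makes
the product of ratios `1` on every non-Hamiltonian simple cycle; since degrees are at least `3`, a
Hamiltonian cycle has a chord and splits into shorter ones. Thus `r` is a coboundary
(`exists_potential`), and rescaling at the vertices makes the forces on each edge opposite. -/

/-! ### Forces as linear functionals -/

/-- The functional `x ↦ det (p, q, x)` belonging to the force `dp ∧ dq`. -/
def form : TwoForm →ₗ[ℝ] Module.Dual ℝ (Fin 3 → ℝ) where
  toFun F := F ![Pi.single 1 1, Pi.single 2 1] • LinearMap.proj 0 +
    F ![Pi.single 2 1, Pi.single 0 1] • LinearMap.proj 1 +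
    F ![Pi.single 0 1, Pi.single 1 1] • LinearMap.proj 2
  map_add' F F' := by
    ext i
    simp
    ring
  map_smul' c F := by
    ext i
    simp
    ring

theorem form_dWedge (p q x : Fin 3 → ℝ) : form (dWedge p q) x = x ⬝ᵥ crossProduct p q := by
  simp [form, dWedge_apply, cross_apply, Fin.sum_univ_three, dotProduct]
  ring

theorem form_injective : Function.Injective form := by
  rw [injective_iff_map_eq_zero]
  intro F hF
  have h0 := LinearMap.congr_fun hF (Pi.single 0 1)
  have h1 := LinearMap.congr_fun hF (Pi.single 1 1)
  have h2 := LinearMap.congr_fun hF (Pi.single 2 1)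
  simp [form] at h0 h1 h2
  have swap : ∀ x y : Fin 3 → ℝ, F ![y, x] = - F ![x, y] := by
    intro x y
    have := F.map_swap ![x, y] (i := 0) (j := 1) (by simp)
    rw [← this]
    congr 1
    ext i
    fin_cases i <;> simp
  refine (Pi.basisFun ℝ (Fin 3)).ext_alternating ?_
  intro v hv
  have e : (fun i => Pi.basisFun ℝ (Fin 3) (v i)) =
      ![Pi.single (v 0) 1, Pi.single (v 1) 1] := by
    ext i
    fin_cases i <;> simp [Pi.basisFun_apply]
  rw [e]
  have hne : v 0 ≠ v 1 := fun h => by simpa using hv h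
  generalize v 0 = a at *
  generalize v 1 = b at *
  fin_cases a <;> fin_cases b <;> first
    | exact absurd rfl hne
    | simpa using h0
    | simpa using h1
    | simpa using h2
    | (rw [swap]; simpa using h0)
    | (rw [swap]; simpa using h1)
    | (rw [swap]; simpa using h2)

theorem form_eq_zero {F : TwoForm} : form F = 0 ↔ F = 0 :=
  map_eq_zero_iff _ form_injective

theorem finrank_ker_dual {g : Module.Dual ℝ (Fin 3 → ℝ)} (hg : g ≠ 0) :
    Module.finrank ℝ (LinearMap.ker g) = 2 := by
  have h := Module.Dual.finrank_ker_add_one_of_ne_zero hg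
  simp at h
  omega

/-- The kernel of a nonzero functional is a plane, so it would coincide with `W` and miss `v`. -/
theorem dual_eq_zero {W : Submodule ℝ (Fin 3 → ℝ)} (hW : Module.finrank ℝ W = 2)
    {v : Fin 3 → ℝ} (hv : v ∉ W) {g : Module.Dual ℝ (Fin 3 → ℝ)} (hg : W ≤ LinearMap.ker g)
    (hgv : g v = 0) : g = 0 := by
  by_contra h
  have := Submodule.eq_of_le_of_finrank_eq hg (by rw [hW, finrank_ker_dual h])
  exact hv (this ▸ hgv)

theorem dual_eq_zero_of_ne {W W' : Submodule ℝ (Fin 3 → ℝ)} (hW : Module.finrank ℝ W = 2)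
    (hW' : Module.finrank ℝ W' = 2) (hne : W ≠ W') {g : Module.Dual ℝ (Fin 3 → ℝ)}
    (hg : W ≤ LinearMap.ker g) (hg' : W' ≤ LinearMap.ker g) : g = 0 := by
  by_contra h
  have h1 := Submodule.eq_of_le_of_finrank_eq hg (by rw [hW, finrank_ker_dual h])
  have h2 := Submodule.eq_of_le_of_finrank_eq hg' (by rw [hW', finrank_ker_dual h])
  exact hne (h1.trans h2.symm)

theorem exists_notMem_of_finrank_eq_two {W : Submodule ℝ (Fin 3 → ℝ)}
    (hW : Module.finrank ℝ W = 2) : ∃ v, v ∉ W := by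
  by_contra! h
  have : W = ⊤ := by
    ext x
    simp [h x]
  rw [this] at hW
  simp at hW

/-- Forces along one line are proportional; the factor is read off at any vector outside `W`. All
scaling factors of the proof come from here. -/
theorem exists_smul_of_le_ker {W : Submodule ℝ (Fin 3 → ℝ)} (hW : Module.finrank ℝ W = 2)
    {F F' : TwoForm} (hF : F ≠ 0) (h : W ≤ LinearMap.ker (form F))
    (h' : W ≤ LinearMap.ker (form F')) : ∃ c : ℝ, F' = c • F := by
  obtain ⟨v, hv⟩ := exists_notMem_of_finrank_eq_two hW
  have hFv : form F v ≠ 0 := fun h0 => hF (form_eq_zero.1 (dual_eq_zero hW hv h h0))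
  refine ⟨form F' v / form F v, ?_⟩
  rw [← sub_eq_zero, ← form_eq_zero]
  refine dual_eq_zero hW hv (fun x hx => ?_) ?_
  · have h1 : form F x = 0 := h hx
    have h2 : form F' x = 0 := h' hx
    simp [h1, h2]
  · simp [hFv]

theorem finrank_span_pair {p q : Fin 3 → ℝ} (h : LinearIndependent ℝ ![p, q]) :
    Module.finrank ℝ (Submodule.span ℝ {p, q}) = 2 := by
  have := finrank_span_eq_card h
  rwa [Fintype.card_fin, Matrix.range_cons, Matrix.range_cons, Matrix.range_empty,
    Set.union_empty, Set.singleton_union] at this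

theorem exists_span_pair_eq {W : Submodule ℝ (Fin 3 → ℝ)} (hW : Module.finrank ℝ W = 2) :
    ∃ p q : Fin 3 → ℝ, LinearIndependent ℝ ![p, q] ∧ Submodule.span ℝ {p, q} = W := by
  let b := Module.finBasisOfFinrankEq ℝ W hW
  have hli : LinearIndependent ℝ ![(b 0 : Fin 3 → ℝ), b 1] := by
    have := b.linearIndependent.map' W.subtype (by simp)
    have e : ![(b 0 : Fin 3 → ℝ), b 1] = W.subtype ∘ b := by
      ext i
      fin_cases i <;> simp
    rwa [e]
  refine ⟨b 0, b 1, hli, Submodule.eq_of_le_of_finrank_eq ?_ ?_⟩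
  · rw [Submodule.span_le]
    rintro x (rfl | rfl)
    · exact (b 0).2
    · exact (b 1).2
  · rw [hW, finrank_span_pair hli]

/-! ### Lines of force as kernels. -/

theorem form_dWedge_eq_zero {p q : Fin 3 → ℝ} :
    form (dWedge p q) = 0 ↔ ¬ LinearIndependent ℝ ![p, q] := by
  rw [← crossProduct_ne_zero_iff_linearIndependent, not_not]
  constructor
  · intro h
    have := LinearMap.congr_fun h (crossProduct p q)
    rw [form_dWedge] at this
    exact dotProduct_self_eq_zero.1 this
  · intro h
    ext i
    simp [form_dWedge, h]

theorem span_le_ker_form (p q : Fin 3 → ℝ) :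
    Submodule.span ℝ {p, q} ≤ LinearMap.ker (form (dWedge p q)) := by
  rw [Submodule.span_le]
  rintro x (rfl | rfl)
  · simp [form_dWedge, dot_self_cross]
  · simp [form_dWedge, dot_cross_self]

/-- The converse contains the decomposability of 2-forms: if `p`, `q` span the kernel, then `dp ∧
dq` is proportional to `F`, and the factor can be absorbed into `p`. -/
theorem isLineOfForce_iff {F : TwoForm} {W : Submodule ℝ (Fin 3 → ℝ)} :
    IsLineOfForce F W ↔ F ≠ 0 ∧ W = LinearMap.ker (form F) := by
  constructor
  · rintro ⟨hF, p, q, rfl, rfl⟩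
    have hF' : form (dWedge p q) ≠ 0 := fun h => hF (form_eq_zero.1 h)
    refine ⟨hF, Submodule.eq_of_le_of_finrank_eq (span_le_ker_form p q) ?_⟩
    rw [finrank_ker_dual hF']
    rw [Ne, form_dWedge_eq_zero, not_not] at hF'
    exact finrank_span_pair hF'
  · rintro ⟨hF, rfl⟩
    have hW := finrank_ker_dual (fun h => hF (form_eq_zero.1 h))
    obtain ⟨p, q, hli, hspan⟩ := exists_span_pair_eq hW
    have hne : dWedge p q ≠ 0 := fun h => form_dWedge_eq_zero.1 (form_eq_zero.2 h) hli
    obtain ⟨c, hc⟩ := exists_smul_of_le_ker hW hne (hspan ▸ span_le_ker_form p q) le_rfl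
    have hc0 : c ≠ 0 := by
      rintro rfl
      exact hF (by simpa using hc)
    refine ⟨hF, c • p, q, ?_, ?_⟩
    · apply form_injective
      ext i
      rw [hc]
      simp [form_dWedge]
    · rw [← hspan, Submodule.span_insert, Submodule.span_insert,
        Submodule.span_singleton_smul_eq (IsUnit.mk0 _ hc0)]

theorem ActsAlong.le_ker {F : TwoForm} {W : Submodule ℝ (Fin 3 → ℝ)} (h : ActsAlong F W) :
    W ≤ LinearMap.ker (form F) := by
  rcases h with rfl | h
  · simp
  · exact (isLineOfForce_iff.1 h).2.le

theorem actsAlong_iff {F : TwoForm} {W : Submodule ℝ (Fin 3 → ℝ)}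
    (hW : Module.finrank ℝ W = 2) : ActsAlong F W ↔ W ≤ LinearMap.ker (form F) := by
  refine ⟨ActsAlong.le_ker, fun h => ?_⟩
  by_cases hF : F = 0
  · exact Or.inl hF
  · have hF' : form F ≠ 0 := fun h => hF (form_eq_zero.1 h)
    exact Or.inr (isLineOfForce_iff.2 ⟨hF,
      Submodule.eq_of_le_of_finrank_eq h (by rw [hW, finrank_ker_dual hF'])⟩)

/-- The line of force of a nonzero force. -/
def lineOf (F : TwoForm) (hF : F ≠ 0) : ProjLine :=
  ⟨LinearMap.ker (form F), finrank_ker_dual (fun h => hF (form_eq_zero.1 h))⟩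

theorem isLineOfForce_ker {F : TwoForm} (hF : F ≠ 0) :
    IsLineOfForce F (LinearMap.ker (form F)) :=
  isLineOfForce_iff.2 ⟨hF, rfl⟩

theorem NonParallelizableSystem.smul {ι : Type*} [Fintype ι] {F : ι → TwoForm}
    (h : NonParallelizableSystem F) {c : ℝ} (hc : c ≠ 0) :
    NonParallelizableSystem (fun i => c • F i) where
  sum_eq_zero A hA := by
    rw [← Finset.smul_sum] at hA
    exact h.sum_eq_zero A ((smul_eq_zero.1 hA).resolve_left hc)
  lines_distinct i A B hiA hiB hA hB hAB ℓ m hℓ hm := by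
    rw [← Finset.smul_sum, isLineOfForce_iff, map_smul, LinearMap.ker_smul _ _ hc,
      smul_ne_zero_iff] at hℓ hm
    exact h.lines_distinct i A B hiA hiB hA hB hAB ℓ m
      (isLineOfForce_iff.2 ⟨hℓ.1.2, hℓ.2⟩) (isLineOfForce_iff.2 ⟨hm.1.2, hm.2⟩)

/-! ### Sides of edges in trees -/

section Tree

variable {W : Type*} {G : SimpleGraph W}

theorem exists_adj_dist_lt (hG : G.IsTree) {x z : W} (h : z ≠ x) :
    ∃ b, G.Adj x b ∧ G.dist z b < G.dist z x := by
  obtain ⟨p, hp⟩ := hG.connected.exists_walk_length_eq_dist x z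
  cases p with
  | nil => exact absurd rfl h
  | cons hb q =>
    refine ⟨_, hb, ?_⟩
    rw [SimpleGraph.dist_comm, SimpleGraph.dist_comm (u := z), ← hp]
    exact Nat.lt_succ_of_le (SimpleGraph.dist_le q)

/-- Two different neighbours of `x` nearer to `z` would start two different paths from `x` to `z`.
So each vertex `z` lies beyond exactly one edge at `x`. -/
theorem eq_of_dist_lt (hG : G.IsTree) {x z b c : W} (hb : G.Adj x b) (hc : G.Adj x c)
    (hzb : G.dist z b < G.dist z x) (hzc : G.dist z c < G.dist z x) : b = c := by
  have key : ∀ d, (hd : G.Adj x d) → G.dist z d < G.dist z x →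
      ∃ p : G.Walk d z, (SimpleGraph.Walk.cons hd p).IsPath := by
    intro d hd hzd
    obtain ⟨p, hp⟩ := hG.connected.exists_walk_length_eq_dist d z
    refine ⟨p, SimpleGraph.Walk.isPath_of_length_eq_dist _ ?_⟩
    have := hG.dist_eq_dist_add_one_of_adj z hd
    rw [SimpleGraph.Walk.length_cons, hp, SimpleGraph.dist_comm, SimpleGraph.dist_comm (u := x)]
    omega
  obtain ⟨p, hp⟩ := key b hb hzb
  obtain ⟨q, hq⟩ := key c hc hzc
  have := (hG.existsUnique_path x z).unique hp hq
  simpa using congrArg SimpleGraph.Walk.snd this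

/-- Sides of edges are nested along a path: otherwise `a` and `c` would both be neighbours of `b`
nearer to `z`. -/
theorem dist_lt_of_adj (hG : G.IsTree) {a b c z : W} (hab : G.Adj a b) (hbc : G.Adj b c)
    (hca : c ≠ a) (h : G.dist z c < G.dist z b) : G.dist z b < G.dist z a := by
  by_contra hn
  have := hG.dist_ne_of_adj z hab
  exact hca (eq_of_dist_lt hG hbc hab.symm h (by omega))

/-- Induction from the leaves inward. The set of vertices beyond `ab` strictly contains the set
beyond each continuing dart `bc`, because `b` drops out. -/
theorem dart_induction [Finite W] (hG : G.IsTree) {p : W → W → Prop}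
    (h : ∀ a b, G.Adj a b → (∀ c, G.Adj b c → c ≠ a → p b c) → p a b) :
    ∀ a b, G.Adj a b → p a b := by
  suffices H : ∀ n a b, G.Adj a b → {z | G.dist z b < G.dist z a}.ncard = n → p a b from
    fun a b hab => H _ a b hab rfl
  intro n
  induction n using Nat.strong_induction_on with
  | _ n ih =>
    rintro a b hab rfl
    refine h a b hab (fun c hbc hca => ih _ ?_ b c hbc rfl)
    refine Set.ncard_lt_ncard ⟨fun z hz => dist_lt_of_adj hG hab hbc hca hz, fun hs => ?_⟩
      (Set.toFinite _)
    have hb : b ∈ {z | G.dist z b < G.dist z a} := by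
      simpa using hG.connected.pos_dist_of_ne hab.ne'
    simpa using hs hb

theorem not_adj_of_adj_of_adj (hG : G.IsTree) {a b c : W} (hab : G.Adj a b) (hac : G.Adj a c) :
    ¬ G.Adj b c := by
  intro hbc
  apply hG.dist_ne_of_adj a hbc
  rw [SimpleGraph.dist_eq_one_iff_adj.2 hab, SimpleGraph.dist_eq_one_iff_adj.2 hac]

end Tree

/-! ### Binary trees and flows -/

namespace BinaryTree

variable {E I : Type*} (T : BinaryTree E I)

theorem exists_leaf_adj_iff (e : E) : ∃ w, ∀ b, T.graph.Adj (Sum.inl e) b ↔ b = w := by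
  obtain ⟨w, hw⟩ := Set.encard_eq_one.1 (T.degree_leaf e)
  exact ⟨w, fun b => by rw [← SimpleGraph.mem_neighborSet, hw, Set.mem_singleton_iff]⟩

theorem leaf_adj_unique {e : E} {a b : E ⊕ I} (ha : T.graph.Adj (Sum.inl e) a)
    (hb : T.graph.Adj (Sum.inl e) b) : a = b := by
  obtain ⟨w, hw⟩ := T.exists_leaf_adj_iff e
  rw [(hw a).1 ha, (hw b).1 hb]

theorem eq_inr_of_adj_of_adj {v a b : E ⊕ I} (ha : T.graph.Adj v a) (hb : T.graph.Adj v b)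
    (hab : a ≠ b) : ∃ x, v = Sum.inr x := by
  rcases v with e | x
  · exact absurd (T.leaf_adj_unique ha hb) hab
  · exact ⟨x, rfl⟩

theorem exists_inner_adj_iff {x : I} {a : E ⊕ I} (ha : T.graph.Adj (Sum.inr x) a) :
    ∃ b c, a ≠ b ∧ a ≠ c ∧ b ≠ c ∧ ∀ y, T.graph.Adj (Sum.inr x) y ↔ y = a ∨ y = b ∨ y = c := by
  obtain ⟨r, s, t, hrs, hrt, hst, h⟩ := Set.encard_eq_three.1 (T.degree_inner x)
  have hadj : ∀ y, T.graph.Adj (Sum.inr x) y ↔ y = r ∨ y = s ∨ y = t := fun y => by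
    rw [← SimpleGraph.mem_neighborSet, h]
    simp
  rcases (hadj a).1 ha with rfl | rfl | rfl
  · exact ⟨s, t, hrs, hrt, hst, hadj⟩
  · exact ⟨r, t, hrs.symm, hst, hrt, fun y => by rw [hadj]; tauto⟩
  · exact ⟨r, s, hrt.symm, hst.symm, hrs, fun y => by rw [hadj]; tauto⟩

theorem exists_third_adj {v a b : E ⊕ I} (ha : T.graph.Adj v a) (hb : T.graph.Adj v b)
    (hab : a ≠ b) : ∃ c, a ≠ c ∧ b ≠ c ∧ ∀ y, T.graph.Adj v y ↔ y = a ∨ y = b ∨ y = c := by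
  obtain ⟨x, rfl⟩ := T.eq_inr_of_adj_of_adj ha hb hab
  obtain ⟨r, s, har, has, hrs, h⟩ := T.exists_inner_adj_iff ha
  rcases (h b).1 hb with rfl | rfl | rfl
  · exact absurd rfl hab
  · exact ⟨s, has, hrs, h⟩
  · exact ⟨r, har, hrs.symm, fun y => by rw [h]; tauto⟩

theorem eq_or_of_adj {v a b c d : E ⊕ I} (ha : T.graph.Adj v a) (hb : T.graph.Adj v b)
    (hc : T.graph.Adj v c) (hab : a ≠ b) (hac : a ≠ c) (hbc : b ≠ c) (hd : T.graph.Adj v d) :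
    d = a ∨ d = b ∨ d = c := by
  obtain ⟨e, -, -, h⟩ := T.exists_third_adj ha hb hab
  have h1 := (h c).1 hc
  have h2 := (h d).1 hd
  grind

theorem exists_adj : ∃ a b, T.graph.Adj a b := by
  obtain ⟨a⟩ := T.isTree.connected.nonempty
  rcases a with e | x
  · obtain ⟨w, hw⟩ := T.exists_leaf_adj_iff e
    exact ⟨_, w, (hw w).2 rfl⟩
  · obtain ⟨r, s, t, -, -, -, h⟩ := Set.encard_eq_three.1 (T.degree_inner x)
    refine ⟨Sum.inr x, r, ?_⟩
    rw [← SimpleGraph.mem_neighborSet, h]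
    simp

variable [Fintype E]

open Classical in
/-- The leaves on the side of `b` of an edge `ab`. -/
def cut (a b : E ⊕ I) : Finset E :=
  Finset.univ.filter fun e => T.graph.dist (Sum.inl e) b < T.graph.dist (Sum.inl e) a

theorem mem_cut {a b : E ⊕ I} {e : E} :
    e ∈ T.cut a b ↔ T.graph.dist (Sum.inl e) b < T.graph.dist (Sum.inl e) a := by
  simp [cut]

open Classical in
/-- The flow with given leaf values. -/
def flow (f : E → TwoForm) (a b : E ⊕ I) : TwoForm :=
  if T.graph.Adj a b then ∑ e ∈ T.cut a b, f e else 0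

variable {T} in
theorem flow_of_adj (f : E → TwoForm) {a b : E ⊕ I} (hab : T.graph.Adj a b) :
    T.flow f a b = ∑ e ∈ T.cut a b, f e := if_pos hab

variable {T} in
theorem mem_cut_swap {a b : E ⊕ I} (hab : T.graph.Adj a b) {e : E} :
    e ∈ T.cut b a ↔ e ∉ T.cut a b := by
  rw [mem_cut, mem_cut]
  have := T.isTree.dist_ne_of_adj (Sum.inl e) hab
  omega

variable {T} in
theorem cut_subset {a b c : E ⊕ I} (hab : T.graph.Adj a b) (hbc : T.graph.Adj b c) (hca : c ≠ a) :
    T.cut b c ⊆ T.cut a b := fun e he => by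
  rw [mem_cut] at he ⊢
  exact dist_lt_of_adj T.isTree hab hbc hca he

variable {T} in
theorem cut_disjoint {a b c : E ⊕ I} (hab : T.graph.Adj b a) (hbc : T.graph.Adj b c) (hca : c ≠ a)
    {e : E} (he : e ∈ T.cut b c) : e ∉ T.cut b a :=
  (mem_cut_swap hab).1 (cut_subset hab.symm hbc hca he)

variable {T} in
theorem cut_leaf {w : E ⊕ I} {e : E} (hw : T.graph.Adj w (Sum.inl e)) :
    T.cut w (Sum.inl e) = {e} := by
  ext e'
  rw [Finset.mem_singleton, mem_cut]
  constructor
  · intro h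
    by_contra hne
    obtain ⟨b, hb, hlt⟩ := exists_adj_dist_lt T.isTree (x := Sum.inl e) (z := Sum.inl e')
      (by simpa using hne)
    rw [T.leaf_adj_unique hb hw.symm] at hlt
    omega
  · rintro rfl
    rw [SimpleGraph.dist_self]
    exact T.isTree.connected.pos_dist_of_ne hw.ne'

variable [Fintype I]

/-- Antisymmetric functions on the darts of a tree with zero sum at all vertices of degree `3`. -/
structure IsFlow (F : E ⊕ I → E ⊕ I → TwoForm) : Prop where
  antisymm : ∀ a b, F a b + F b a = 0
  zero : ∀ a b, ¬ T.graph.Adj a b → F a b = 0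
  equilibrium : ∀ x : I, ∑ b, F (Sum.inr x) b = 0

variable {T} {F : E ⊕ I → E ⊕ I → TwoForm}

namespace IsFlow

theorem swap (h : T.IsFlow F) (a b : E ⊕ I) : F b a = - F a b :=
  eq_neg_of_add_eq_zero_right (h.antisymm a b)

theorem sum_eq_three (h : T.IsFlow F) {v a b c : E ⊕ I} (hab : a ≠ b) (hac : a ≠ c) (hbc : b ≠ c)
    (hv : ∀ y, T.graph.Adj v y ↔ y = a ∨ y = b ∨ y = c) :
    ∑ y, F v y = F v a + F v b + F v c := by
  classical
  rw [← Finset.sum_subset (Finset.subset_univ {a, b, c})]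
  · rw [Finset.sum_insert (by simp [hab, hac]), Finset.sum_insert (by simp [hbc]),
      Finset.sum_singleton, add_assoc]
  · intro y _ hy
    refine h.zero _ _ (fun hvy => hy ?_)
    simpa using (hv y).1 hvy

theorem add_add_eq_zero (h : T.IsFlow F) {v a b c : E ⊕ I} (ha : T.graph.Adj v a)
    (hb : T.graph.Adj v b) (hc : T.graph.Adj v c) (hab : a ≠ b) (hac : a ≠ c) (hbc : b ≠ c) :
    F v a + F v b + F v c = 0 := by
  obtain ⟨x, rfl⟩ := T.eq_inr_of_adj_of_adj ha hb hab
  rw [← h.equilibrium x, h.sum_eq_three hab hac hbc]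
  refine fun y => ⟨fun hy => T.eq_or_of_adj ha hb hc hab hac hbc hy, ?_⟩
  rintro (rfl | rfl | rfl) <;> assumption

theorem leafForce_eq (h : T.IsFlow F) {e : E} {w : E ⊕ I} (hw : T.graph.Adj w (Sum.inl e)) :
    ResolutionScheme.leafForce F e = F w (Sum.inl e) := by
  refine Finset.sum_eq_single w (fun y _ hy => ?_) (by simp)
  exact h.zero _ _ (fun hy' => hy (T.leaf_adj_unique hy'.symm hw.symm))

/-- The sum over all darts vanishes by antisymmetry, and inner vertices contribute nothing to it, so
only the leaf ends remain. -/
theorem sum_leafForce (h : T.IsFlow F) : ∑ e, ResolutionScheme.leafForce F e = 0 := by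
  have h1 : ∑ a, ∑ b, F a b = 0 := by
    have h2 : ∑ a, ∑ b, F a b = - ∑ a, ∑ b, F a b := by
      conv_lhs => rw [Finset.sum_comm]
      rw [← Finset.sum_neg_distrib]
      refine Finset.sum_congr rfl fun a _ => ?_
      rw [← Finset.sum_neg_distrib]
      exact Finset.sum_congr rfl fun b _ => h.swap a b
    rw [eq_neg_iff_add_eq_zero, ← two_smul ℝ, smul_eq_zero] at h2
    exact h2.resolve_left two_ne_zero
  rw [Fintype.sum_sum_type] at h1
  simp_rw [h.equilibrium, Finset.sum_const_zero, add_zero] at h1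
  have h3 : ∀ e, ResolutionScheme.leafForce F e = - ∑ b, F (Sum.inl e) b := fun e => by
    rw [ResolutionScheme.leafForce, ← Finset.sum_neg_distrib]
    exact Finset.sum_congr rfl fun b _ => h.swap _ _
  simp_rw [h3, Finset.sum_neg_distrib, h1, neg_zero]

theorem sub (h : T.IsFlow F) {F' : E ⊕ I → E ⊕ I → TwoForm} (h' : T.IsFlow F') (c : ℝ) :
    T.IsFlow (fun a b => F a b - c • F' a b) where
  antisymm a b := by
    rw [h.swap a b, h'.swap a b]
    module
  zero a b hab := by rw [h.zero a b hab, h'.zero a b hab, smul_zero, sub_zero]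
  equilibrium x := by
    rw [Finset.sum_sub_distrib, ← Finset.smul_sum, h.equilibrium, h'.equilibrium, smul_zero,
      sub_zero]

/-- A flow is determined by its leaf values. -/
theorem eq_zero_of_leafForce (h : T.IsFlow F) (h0 : ResolutionScheme.leafForce F = 0) : F = 0 := by
  have H : ∀ a b, T.graph.Adj a b → F a b = 0 := by
    refine dart_induction T.isTree fun a b hab ih => ?_
    rcases b with e | x
    · rw [← h.leafForce_eq hab, h0, Pi.zero_apply]
    · obtain ⟨c, d, hac, had, hcd, hx⟩ := T.exists_inner_adj_iff hab.symm
      have := h.add_add_eq_zero hab.symm ((hx c).2 (by simp)) ((hx d).2 (by simp)) hac had hcd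
      rw [ih c ((hx c).2 (by simp)) hac.symm, ih d ((hx d).2 (by simp)) had.symm, add_zero,
        add_zero] at this
      rw [h.swap (Sum.inr x) a, this, neg_zero]
  ext a b : 2
  by_cases hab : T.graph.Adj a b
  · exact H a b hab
  · exact h.zero a b hab

theorem eq_of_leafForce_eq (h : T.IsFlow F) {F' : E ⊕ I → E ⊕ I → TwoForm} (h' : T.IsFlow F')
    (he : ResolutionScheme.leafForce F = ResolutionScheme.leafForce F') : F = F' := by
  have := (h.sub h' 1).eq_zero_of_leafForce (by
    ext1 e
    have := congrFun he e
    simp only [ResolutionScheme.leafForce] at this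
    simp [ResolutionScheme.leafForce, this])
  ext a b : 2
  have := congrFun (congrFun this a) b
  simpa [sub_eq_zero] using this

end IsFlow

/-! ### Flows with prescribed leaf values. -/

theorem cut_nonempty {a b : E ⊕ I} (hab : T.graph.Adj a b) : (T.cut a b).Nonempty := by
  refine dart_induction (p := fun a b => (T.cut a b).Nonempty) T.isTree
    (fun a b hab ih => ?_) a b hab
  rcases b with e | x
  · refine ⟨e, ?_⟩
    rw [mem_cut, SimpleGraph.dist_self]
    exact T.isTree.connected.pos_dist_of_ne hab.ne'
  · obtain ⟨c, d, hac, -, -, hx⟩ := T.exists_inner_adj_iff hab.symm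
    exact (ih c ((hx c).2 (by simp)) hac.symm).mono (cut_subset hab ((hx c).2 (by simp)) hac.symm)

theorem cut_ne_univ {a b : E ⊕ I} (hab : T.graph.Adj a b) : T.cut a b ≠ Finset.univ := by
  intro h
  obtain ⟨e, he⟩ := cut_nonempty hab.symm
  exact (mem_cut_swap hab).1 he (h ▸ Finset.mem_univ e)

/-- The two sides of an edge partition the leaves, which gives antisymmetry. At an inner vertex each
leaf lies beyond exactly one of the three edges, so the three cut sums add up to the total. -/
theorem isFlow_flow {f : E → TwoForm} (hf : ∑ e, f e = 0) : T.IsFlow (T.flow f) where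
  antisymm a b := by
    by_cases hab : T.graph.Adj a b
    · classical
      rw [flow_of_adj f hab, flow_of_adj f hab.symm, ← hf]
      have : T.cut b a = (T.cut a b)ᶜ := by
        ext e
        rw [mem_cut_swap hab, Finset.mem_compl]
      rw [this, Finset.sum_add_sum_compl]
    · rw [flow, flow, if_neg hab, if_neg fun h => hab h.symm, add_zero]
  zero a b hab := if_neg hab
  equilibrium x := by
    classical
    have h : ∀ b, T.flow f (Sum.inr x) b =
        ∑ e, if T.graph.Adj (Sum.inr x) b ∧ e ∈ T.cut (Sum.inr x) b then f e else 0 := by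
      intro b
      by_cases hab : T.graph.Adj (Sum.inr x) b
      · rw [flow_of_adj f hab]
        simp [hab, Finset.sum_ite_mem]
      · simp [flow, hab]
    simp_rw [h]
    rw [Finset.sum_comm]
    refine (Finset.sum_congr rfl fun e _ => ?_).trans hf
    obtain ⟨b, hb, hlt⟩ := exists_adj_dist_lt T.isTree (x := Sum.inr x) (z := Sum.inl e) (by simp)
    rw [Finset.sum_eq_single b]
    · rw [if_pos ⟨hb, T.mem_cut.2 hlt⟩]
    · rintro c - hc
      refine if_neg fun h => hc ?_
      exact eq_of_dist_lt T.isTree h.1 hb (T.mem_cut.1 h.2) hlt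
    · simp

theorem leafForce_flow {f : E → TwoForm} (hf : ∑ e, f e = 0) :
    ResolutionScheme.leafForce (T.flow f) = f := by
  ext1 e
  obtain ⟨w, hw⟩ := T.exists_leaf_adj_iff e
  have hw' := ((hw w).2 rfl).symm
  rw [(isFlow_flow hf).leafForce_eq hw', flow_of_adj f hw', cut_leaf hw', Finset.sum_singleton]

theorem flow_ne_zero {f : E → TwoForm} (hf : NonParallelizableSystem f) {a b : E ⊕ I}
    (hab : T.graph.Adj a b) : T.flow f a b ≠ 0 := by
  rw [flow_of_adj f hab]
  intro h
  rcases hf.sum_eq_zero _ h with h | h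
  · exact (cut_nonempty hab).ne_empty h
  · exact cut_ne_univ hab h

/-- The leaves beyond `bc` form a nonempty proper subset of those beyond `ab`, the third edge at `b`
accounting for the rest. Both sums contain a common leaf, so condition (b) separates their lines. -/
theorem ker_flow_ne {f : E → TwoForm} (hf : NonParallelizableSystem f)
    {a b c : E ⊕ I} (hab : T.graph.Adj a b) (hbc : T.graph.Adj b c) (hac : a ≠ c) :
    LinearMap.ker (form (T.flow f a b)) ≠ LinearMap.ker (form (T.flow f b c)) := by
  obtain ⟨d, had, hcd, hb⟩ := T.exists_third_adj hab.symm hbc hac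
  have hbd : T.graph.Adj b d := (hb d).2 (by simp)
  obtain ⟨e, he⟩ := cut_nonempty hbc
  obtain ⟨e', he'⟩ := cut_nonempty hbd
  have h1 := isLineOfForce_ker (flow_ne_zero hf hab)
  have h2 := isLineOfForce_ker (flow_ne_zero hf hbc)
  rw [flow_of_adj f hab] at h1 ⊢
  rw [flow_of_adj f hbc] at h2 ⊢
  refine hf.lines_distinct e _ _ (cut_subset hab hbc hac.symm he) he (cut_ne_univ hab)
    (cut_ne_univ hbc) (fun h => ?_) _ _ h1 h2
  exact cut_disjoint hbc hbd hcd.symm he' (h ▸ cut_subset hab hbd had.symm he')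

end BinaryTree

namespace BinaryTree

/-! ### Counting edges of binary trees -/

section Count

variable {E I : Type*} [Fintype E] [Fintype I] {G : SimpleGraph (E ⊕ I)}

theorem two_mul_card_edgeSet (hE : ∀ e, (G.neighborSet (Sum.inl e)).encard = 1)
    (hI : ∀ x, (G.neighborSet (Sum.inr x)).encard = 3) :
    2 * Nat.card G.edgeSet = Fintype.card E + 3 * Fintype.card I := by
  classical
  have hdeg : ∀ v, (G.degree v : ℕ∞) = (G.neighborSet v).encard := fun v => by
    rw [← SimpleGraph.card_neighborFinset_eq_degree, SimpleGraph.neighborFinset,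
      Set.encard_eq_coe_toFinset_card]
  have h := G.sum_degrees_eq_twice_card_edges
  rw [Fintype.sum_sum_type] at h
  have h1 : ∀ e, G.degree (Sum.inl e) = 1 := fun e => by
    have := hdeg (Sum.inl e)
    rw [hE] at this
    exact_mod_cast this
  have h2 : ∀ x, G.degree (Sum.inr x) = 3 := fun x => by
    have := hdeg (Sum.inr x)
    rw [hI] at this
    exact_mod_cast this
  simp only [h1, h2, Finset.sum_const, Finset.card_univ, smul_eq_mul] at h
  rw [Nat.card_eq_fintype_card, ← SimpleGraph.edgeFinset_card]
  omega

theorem card_inner_add_two (T : BinaryTree E I) : Fintype.card I + 2 = Fintype.card E := by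
  have h := two_mul_card_edgeSet T.degree_leaf T.degree_inner
  have h' := (SimpleGraph.isTree_iff_connected_and_card.1 T.isTree).2
  rw [Nat.card_sum, Nat.card_eq_fintype_card (α := E), Nat.card_eq_fintype_card (α := I)] at h'
  omega

/-- With degrees `1` and `3` prescribed, the number of edges is determined, so acyclicity follows
from connectedness by counting. -/
theorem isTree_of_connected (hG : G.Connected)
    (hE : ∀ e, (G.neighborSet (Sum.inl e)).encard = 1)
    (hI : ∀ x, (G.neighborSet (Sum.inr x)).encard = 3)
    (hcard : Fintype.card I + 2 = Fintype.card E) : G.IsTree := by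
  refine SimpleGraph.isTree_iff_connected_and_card.2 ⟨hG, ?_⟩
  have h := two_mul_card_edgeSet hE hI
  rw [Nat.card_sum, Nat.card_eq_fintype_card (α := E), Nat.card_eq_fintype_card (α := I)]
  omega

end Count

/-! ### Surgeries of trees -/

section Surgery

variable {E I : Type*}

/-- The combinatorial part of an HΦ-surgery. -/
structure IsSurgeryAt (T T' : BinaryTree E I) (v₁ v₂ v₃ v₄ v₅ v₆ : E ⊕ I) : Prop where
  nodup : [v₁, v₂, v₃, v₄, v₅, v₆].Nodup
  adj₁₂ : T.graph.Adj v₁ v₂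
  adj₁₃ : T.graph.Adj v₁ v₃
  adj₁₄ : T.graph.Adj v₁ v₄
  adj₂₅ : T.graph.Adj v₂ v₅
  adj₂₆ : T.graph.Adj v₂ v₆
  edges : T'.graph.edgeSet =
    (T.graph.edgeSet \ {s(v₁, v₄), s(v₂, v₅)}) ∪ {s(v₁, v₅), s(v₂, v₄)}

namespace IsSurgeryAt

variable {T T' : BinaryTree E I} {v₁ v₂ v₃ v₄ v₅ v₆ : E ⊕ I}

theorem adj_iff (h : IsSurgeryAt T T' v₁ v₂ v₃ v₄ v₅ v₆) (a b : E ⊕ I) : T'.graph.Adj a b ↔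
    (T.graph.Adj a b ∧ s(a, b) ≠ s(v₁, v₄) ∧ s(a, b) ≠ s(v₂, v₅)) ∨
      s(a, b) = s(v₁, v₅) ∨ s(a, b) = s(v₂, v₄) := by
  rw [← SimpleGraph.mem_edgeSet, h.edges]
  simp only [Set.mem_union, Set.mem_sdiff, Set.mem_insert_iff, Set.mem_singleton_iff, not_or,
      SimpleGraph.mem_edgeSet, Ne]

theorem adj₁₅' (h : IsSurgeryAt T T' v₁ v₂ v₃ v₄ v₅ v₆) : T'.graph.Adj v₁ v₅ := by
  rw [h.adj_iff]
  simp

theorem not_adj₁₄' (h : IsSurgeryAt T T' v₁ v₂ v₃ v₄ v₅ v₆) : ¬ T'.graph.Adj v₁ v₄ := by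
  have hn := h.nodup
  simp only [List.nodup_cons, List.mem_cons, List.not_mem_nil, or_false, not_or, not_false_eq_true,
    List.nodup_nil, and_true] at hn
  simp only [h.adj_iff, Sym2.eq_iff]
  tauto

theorem not_adj₂₅' (h : IsSurgeryAt T T' v₁ v₂ v₃ v₄ v₅ v₆) : ¬ T'.graph.Adj v₂ v₅ := by
  have hn := h.nodup
  simp only [List.nodup_cons, List.mem_cons, List.not_mem_nil, or_false, not_or, not_false_eq_true,
    List.nodup_nil, and_true] at hn
  simp only [h.adj_iff, Sym2.eq_iff]
  tauto

end IsSurgeryAt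

/-- The graph obtained by an HΦ-surgery. -/
def surgeryGraph (G : SimpleGraph (E ⊕ I)) (v₁ v₂ v₄ v₅ : E ⊕ I) : SimpleGraph (E ⊕ I) :=
  SimpleGraph.fromEdgeSet ((G.edgeSet \ {s(v₁, v₄), s(v₂, v₅)}) ∪ {s(v₁, v₅), s(v₂, v₄)})

theorem edgeSet_surgeryGraph (G : SimpleGraph (E ⊕ I)) {v₁ v₂ v₄ v₅ : E ⊕ I} (h₁₅ : v₁ ≠ v₅)
    (h₂₄ : v₂ ≠ v₄) : (surgeryGraph G v₁ v₂ v₄ v₅).edgeSet =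
      (G.edgeSet \ {s(v₁, v₄), s(v₂, v₅)}) ∪ {s(v₁, v₅), s(v₂, v₄)} := by
  rw [surgeryGraph, SimpleGraph.edgeSet_fromEdgeSet, sdiff_eq_left, Set.disjoint_left]
  rintro e (⟨he, -⟩ | rfl | rfl) hd
  · exact G.not_isDiag_of_mem_edgeSet he hd
  · exact h₁₅ (by simpa using hd)
  · exact h₂₄ (by simpa using hd)

theorem surgeryGraph_connected {G : SimpleGraph (E ⊕ I)} {v₁ v₂ v₄ v₅ : E ⊕ I} (hG : G.Connected)
    (h₁₅ : v₁ ≠ v₅) (h₂₄ : v₂ ≠ v₄) (h₁₂ : v₁ ≠ v₂) (h₄₅ : v₄ ≠ v₅) (hadj : G.Adj v₁ v₂) :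
    (surgeryGraph G v₁ v₂ v₄ v₅).Connected := by
  have hedge := edgeSet_surgeryGraph G h₁₅ h₂₄
  have ha : ∀ a b, s(a, b) ∈ (G.edgeSet \ {s(v₁, v₄), s(v₂, v₅)}) ∪ {s(v₁, v₅), s(v₂, v₄)} →
      (surgeryGraph G v₁ v₂ v₄ v₅).Reachable a b := fun a b h =>
    SimpleGraph.Adj.reachable ((SimpleGraph.mem_edgeSet _).1 (hedge ▸ h))
  -- The removed edges `v₁v₄` and `v₂v₅` are replaced by the detours `v₁v₂v₄` and `v₂v₁v₅`.
  have h12 := ha v₁ v₂ (by simp [hadj]; grind)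
  have h15 := ha v₁ v₅ (by simp)
  have h24 := ha v₂ v₄ (by simp)
  have hr : ∀ a b, G.Adj a b → (surgeryGraph G v₁ v₂ v₄ v₅).Reachable a b := by
    intro a b hab
    by_cases h : s(a, b) = s(v₁, v₄)
    · rcases Sym2.eq_iff.1 h with ⟨rfl, rfl⟩ | ⟨rfl, rfl⟩
      · exact h12.trans h24
      · exact (h12.trans h24).symm
    · by_cases h' : s(a, b) = s(v₂, v₅)
      · rcases Sym2.eq_iff.1 h' with ⟨rfl, rfl⟩ | ⟨rfl, rfl⟩
        · exact h12.symm.trans h15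
        · exact (h12.symm.trans h15).symm
      · exact ha a b (Or.inl ⟨hab, by simp only [Set.mem_insert_iff, Set.mem_singleton_iff]; tauto⟩)
  have := hG.nonempty
  refine SimpleGraph.Connected.mk fun a b => ?_
  obtain ⟨p⟩ := hG.preconnected a b
  induction p with
  | nil => exact SimpleGraph.Reachable.refl _
  | cons h _ ih => exact (hr _ _ h).trans ih

theorem exists_isSurgeryAt [Fintype E] [Fintype I] (T : BinaryTree E I)
    {v₁ v₂ v₃ v₄ v₅ v₆ : E ⊕ I} (nodup : [v₁, v₂, v₃, v₄, v₅, v₆].Nodup)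
    (adj₁₂ : T.graph.Adj v₁ v₂) (adj₁₃ : T.graph.Adj v₁ v₃) (adj₁₄ : T.graph.Adj v₁ v₄)
    (adj₂₅ : T.graph.Adj v₂ v₅) (adj₂₆ : T.graph.Adj v₂ v₆) :
    ∃ T', IsSurgeryAt T T' v₁ v₂ v₃ v₄ v₅ v₆ := by
  classical
  have hn := nodup
  simp only [List.nodup_cons, List.mem_cons, List.not_mem_nil, or_false, not_or, not_false_eq_true,
    List.nodup_nil, and_true] at hn
  have hedge := edgeSet_surgeryGraph T.graph (v₁ := v₁) (v₂ := v₂) (v₄ := v₄) (v₅ := v₅)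
    (by tauto) (by tauto)
  have hadj : ∀ a b, (surgeryGraph T.graph v₁ v₂ v₄ v₅).Adj a b ↔
      (T.graph.Adj a b ∧ s(a, b) ≠ s(v₁, v₄) ∧ s(a, b) ≠ s(v₂, v₅)) ∨
        s(a, b) = s(v₁, v₅) ∨ s(a, b) = s(v₂, v₄) := fun a b => by
    rw [← SimpleGraph.mem_edgeSet, hedge]
    simp only [Set.mem_union, Set.mem_sdiff, Set.mem_insert_iff, Set.mem_singleton_iff, not_or,
      SimpleGraph.mem_edgeSet, Ne]
  have h24 : ¬ T.graph.Adj v₂ v₄ := not_adj_of_adj_of_adj T.isTree adj₁₂ adj₁₄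
  have h15 : ¬ T.graph.Adj v₁ v₅ := not_adj_of_adj_of_adj T.isTree adj₁₂.symm adj₂₅
  have hdeg : ∀ x, ((surgeryGraph T.graph v₁ v₂ v₄ v₅).neighborSet x).encard =
      (T.graph.neighborSet x).encard := by
    intro x
    -- Degrees survive because each neighbourhood changes by a permutation of the vertices: `v₄ ↔
    -- v₅` at `v₁` and `v₂`, `v₁ ↔ v₂` at `v₄` and `v₅`, the identity elsewhere. Absence of
    -- triangles ensures that the two new edges are not already present.
    have key : ∀ σ : Equiv.Perm (E ⊕ I),
        (∀ y, (surgeryGraph T.graph v₁ v₂ v₄ v₅).Adj x y ↔ T.graph.Adj x (σ y)) →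
        ((surgeryGraph T.graph v₁ v₂ v₄ v₅).neighborSet x).encard =
          (T.graph.neighborSet x).encard := by
      intro σ hσ
      have : (surgeryGraph T.graph v₁ v₂ v₄ v₅).neighborSet x =
          σ.symm '' T.graph.neighborSet x := by
        ext y
        simp [Equiv.image_eq_preimage_symm, hσ]
      rw [this, σ.symm.injective.encard_image]
    by_cases hx : x = v₁ ∨ x = v₂
    · refine key (Equiv.swap v₄ v₅) fun y => ?_
      rw [hadj, Equiv.swap_apply_def]
      simp only [Sym2.eq_iff, Ne]
      have := adj₁₄.symm
      have := adj₂₅.symm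
      grind
    · by_cases hx' : x = v₄ ∨ x = v₅
      · refine key (Equiv.swap v₁ v₂) fun y => ?_
        rw [hadj, Equiv.swap_apply_def]
        simp only [Sym2.eq_iff, Ne]
        have := adj₁₄.symm
        have := adj₂₅.symm
        rw [T.graph.adj_comm] at h15 h24
        grind
      · refine key 1 fun y => ?_
        rw [hadj]
        simp only [Sym2.eq_iff, Ne, Equiv.Perm.coe_one, id]
        grind
  have hE : ∀ e, ((surgeryGraph T.graph v₁ v₂ v₄ v₅).neighborSet (Sum.inl e)).encard = 1 :=
    fun e => by rw [hdeg, T.degree_leaf]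
  have hI : ∀ x, ((surgeryGraph T.graph v₁ v₂ v₄ v₅).neighborSet (Sum.inr x)).encard = 3 :=
    fun x => by rw [hdeg, T.degree_inner]
  have hconn := surgeryGraph_connected T.isTree.connected (v₁ := v₁) (v₂ := v₂) (v₄ := v₄)
    (v₅ := v₅) (by tauto) (by tauto) (by tauto) (by tauto) adj₁₂
  exact ⟨⟨surgeryGraph T.graph v₁ v₂ v₄ v₅, isTree_of_connected hconn hE hI T.card_inner_add_two,
    hE, hI⟩, nodup, adj₁₂, adj₁₃, adj₁₄, adj₂₅, adj₂₆, hedge⟩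

/-! ### The effect of surgeries on flows -/

open Classical in
/-- The antisymmetric function with value `m` at the dart `ab`. -/
def dartFlow (a b : E ⊕ I) (m : TwoForm) (x y : E ⊕ I) : TwoForm :=
  (if x = a ∧ y = b then m else 0) - (if x = b ∧ y = a then m else 0)

theorem dartFlow_of_ne {a b x y : E ⊕ I} (h : s(x, y) ≠ s(a, b)) (m : TwoForm) :
    dartFlow a b m x y = 0 := by
  rw [Ne, Sym2.eq_iff] at h
  rw [dartFlow, if_neg (by tauto), if_neg (by tauto), sub_zero]

theorem dartFlow_self {a b : E ⊕ I} (h : a ≠ b) (m : TwoForm) : dartFlow a b m a b = m := by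
  simp [dartFlow, h]

theorem dartFlow_swap (a b : E ⊕ I) (m : TwoForm) (x y : E ⊕ I) :
    dartFlow a b m y x = - dartFlow a b m x y := by
  rw [dartFlow, dartFlow, neg_sub]
  split_ifs <;> first | rfl | (exfalso; tauto)

open Classical in
theorem sum_dartFlow [Fintype E] [Fintype I] (a b : E ⊕ I) (m : TwoForm) (x : E ⊕ I) :
    ∑ y, dartFlow a b m x y = (if x = a then m else 0) - (if x = b then m else 0) := by
  simp only [dartFlow, Finset.sum_sub_distrib]
  congr 1
  · by_cases h : x = a <;> simp [h]
  · by_cases h : x = b <;> simp [h]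

/-- The effect of an HΦ-surgery on a flow. -/
def surgeryFlow (F : E ⊕ I → E ⊕ I → TwoForm) (v₁ v₂ v₄ v₅ : E ⊕ I) (x y : E ⊕ I) : TwoForm :=
  F x y - dartFlow v₁ v₄ (F v₁ v₄) x y - dartFlow v₂ v₅ (F v₂ v₅) x y +
    dartFlow v₁ v₅ (F v₂ v₅) x y + dartFlow v₂ v₄ (F v₁ v₄) x y +
    dartFlow v₁ v₂ (F v₁ v₄ - F v₂ v₅) x y

theorem surgeryFlow_of_ne (F : E ⊕ I → E ⊕ I → TwoForm) {v₁ v₂ v₄ v₅ x y : E ⊕ I}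
    (h₁₄ : s(x, y) ≠ s(v₁, v₄)) (h₂₅ : s(x, y) ≠ s(v₂, v₅)) (h₁₅ : s(x, y) ≠ s(v₁, v₅))
    (h₂₄ : s(x, y) ≠ s(v₂, v₄)) (h₁₂ : s(x, y) ≠ s(v₁, v₂)) :
    surgeryFlow F v₁ v₂ v₄ v₅ x y = F x y := by
  simp [surgeryFlow, dartFlow_of_ne, *]

theorem IsSurgeryAt.surgeryFlow₁₄ {T T' : BinaryTree E I} {v₁ v₂ v₃ v₄ v₅ v₆ : E ⊕ I}
    {F : E ⊕ I → E ⊕ I → TwoForm} (h : IsSurgeryAt T T' v₁ v₂ v₃ v₄ v₅ v₆) :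
    surgeryFlow F v₁ v₂ v₄ v₅ v₁ v₄ = 0 := by
  have hn := h.nodup
  simp only [List.nodup_cons, List.mem_cons, List.not_mem_nil, or_false, not_or, not_false_eq_true,
    List.nodup_nil, and_true] at hn
  rw [surgeryFlow, dartFlow_self (by tauto), dartFlow_of_ne, dartFlow_of_ne, dartFlow_of_ne,
    dartFlow_of_ne]
  · simp
  all_goals
    rw [Ne, Sym2.eq_iff]
    tauto

theorem IsSurgeryAt.surgeryFlow₂₅ {T T' : BinaryTree E I} {v₁ v₂ v₃ v₄ v₅ v₆ : E ⊕ I}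
    {F : E ⊕ I → E ⊕ I → TwoForm} (h : IsSurgeryAt T T' v₁ v₂ v₃ v₄ v₅ v₆) :
    surgeryFlow F v₁ v₂ v₄ v₅ v₂ v₅ = 0 := by
  have hn := h.nodup
  simp only [List.nodup_cons, List.mem_cons, List.not_mem_nil, or_false, not_or, not_false_eq_true,
    List.nodup_nil, and_true] at hn
  rw [surgeryFlow, dartFlow_of_ne, dartFlow_self (by tauto), dartFlow_of_ne, dartFlow_of_ne,
    dartFlow_of_ne]
  · simp
  all_goals
    rw [Ne, Sym2.eq_iff]
    tauto

theorem IsSurgeryAt.surgeryFlow_of_adj {T T' : BinaryTree E I} {v₁ v₂ v₃ v₄ v₅ v₆ : E ⊕ I}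
    (h : IsSurgeryAt T T' v₁ v₂ v₃ v₄ v₅ v₆)
    (F : E ⊕ I → E ⊕ I → TwoForm) {a b : E ⊕ I} (hab : T.graph.Adj a b) (hab' : T'.graph.Adj a b)
    (h₁₂ : s(a, b) ≠ s(v₁, v₂)) : surgeryFlow F v₁ v₂ v₄ v₅ a b = F a b := by
  rw [← SimpleGraph.mem_edgeSet] at hab hab'
  refine surgeryFlow_of_ne F (fun e => ?_) (fun e => ?_) (fun e => ?_) (fun e => ?_) h₁₂
  · exact h.not_adj₁₄' (by rwa [e] at hab')
  · exact h.not_adj₂₅' (by rwa [e] at hab')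
  · exact not_adj_of_adj_of_adj T.isTree h.adj₁₂.symm h.adj₂₅ (by rwa [e] at hab)
  · exact not_adj_of_adj_of_adj T.isTree h.adj₁₂ h.adj₁₄ (by rwa [e] at hab)

variable [Fintype E] [Fintype I]

/-- The change is a circulation: the force on `v₁v₄` is rerouted along `v₁v₂v₄` and the one on
`v₂v₅` along `v₂v₁v₅`. Hence neither equilibrium nor leaf forces are affected. -/
theorem sum_surgeryFlow (F : E ⊕ I → E ⊕ I → TwoForm) (v₁ v₂ v₄ v₅ x : E ⊕ I) :
    ∑ y, surgeryFlow F v₁ v₂ v₄ v₅ x y = ∑ y, F x y := by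
  classical
  simp only [surgeryFlow, Finset.sum_add_distrib, Finset.sum_sub_distrib, sum_dartFlow]
  by_cases h1 : x = v₁ <;> by_cases h2 : x = v₂ <;> simp only [h1, h2, if_true, if_false] 
  all_goals split_ifs <;> abel

theorem IsFlow.surgeryFlow_swap {T : BinaryTree E I} {F : E ⊕ I → E ⊕ I → TwoForm}
    (hF : T.IsFlow F) (v₁ v₂ v₄ v₅ x y : E ⊕ I) :
    surgeryFlow F v₁ v₂ v₄ v₅ x y + surgeryFlow F v₁ v₂ v₄ v₅ y x = 0 := by
  simp only [surgeryFlow, dartFlow_swap _ _ _ x y, hF.swap x y]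
  abel

namespace IsSurgeryAt

variable {T T' : BinaryTree E I} {v₁ v₂ v₃ v₄ v₅ v₆ : E ⊕ I} {F : E ⊕ I → E ⊕ I → TwoForm}

theorem surgeryFlow₁₅ (h : IsSurgeryAt T T' v₁ v₂ v₃ v₄ v₅ v₆) (hF : T.IsFlow F) :
    surgeryFlow F v₁ v₂ v₄ v₅ v₁ v₅ = F v₂ v₅ := by
  have hn := h.nodup
  simp only [List.nodup_cons, List.mem_cons, List.not_mem_nil, or_false, not_or, not_false_eq_true,
    List.nodup_nil, and_true] at hn
  rw [surgeryFlow, dartFlow_self (by tauto), dartFlow_of_ne, dartFlow_of_ne, dartFlow_of_ne,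
    dartFlow_of_ne, hF.zero _ _ (not_adj_of_adj_of_adj T.isTree h.adj₁₂.symm h.adj₂₅)]
  · simp
  all_goals
    rw [Ne, Sym2.eq_iff]
    tauto

theorem surgeryFlow₂₄ (h : IsSurgeryAt T T' v₁ v₂ v₃ v₄ v₅ v₆) (hF : T.IsFlow F) :
    surgeryFlow F v₁ v₂ v₄ v₅ v₂ v₄ = F v₁ v₄ := by
  have hn := h.nodup
  simp only [List.nodup_cons, List.mem_cons, List.not_mem_nil, or_false, not_or, not_false_eq_true,
    List.nodup_nil, and_true] at hn
  rw [surgeryFlow, dartFlow_of_ne, dartFlow_of_ne, dartFlow_of_ne, dartFlow_self (by tauto),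
    dartFlow_of_ne, hF.zero _ _ (not_adj_of_adj_of_adj T.isTree h.adj₁₂ h.adj₁₄)]
  · simp
  all_goals
    rw [Ne, Sym2.eq_iff]
    tauto

/-- Rerouting puts `F₁₂ + F₁₄ - F₂₅` on the middle edge, and equilibrium at `v₁` eliminates `F₁₂ +
F₁₄`. This explains the line of `F₁₃ + F₂₅` in the definition of a surgery. -/
theorem surgeryFlow₁₂ (h : IsSurgeryAt T T' v₁ v₂ v₃ v₄ v₅ v₆) (hF : T.IsFlow F) :
    surgeryFlow F v₁ v₂ v₄ v₅ v₁ v₂ = - (F v₁ v₃ + F v₂ v₅) := by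
  have hn := h.nodup
  simp only [List.nodup_cons, List.mem_cons, List.not_mem_nil, or_false, not_or, not_false_eq_true,
    List.nodup_nil, and_true] at hn
  have hsum := hF.add_add_eq_zero h.adj₁₂ h.adj₁₃ h.adj₁₄ (by tauto) (by tauto) (by tauto)
  rw [surgeryFlow, dartFlow_of_ne, dartFlow_of_ne, dartFlow_of_ne, dartFlow_of_ne,
    dartFlow_self (by tauto)]
  · rw [eq_neg_of_add_eq_zero_right (show (F v₁ v₃ + F v₁ v₄) + F v₁ v₂ = 0 by rw [← hsum]; abel)]
    abel
  all_goals
    rw [Ne, Sym2.eq_iff]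
    tauto

theorem isFlow (h : IsSurgeryAt T T' v₁ v₂ v₃ v₄ v₅ v₆) (hF : T.IsFlow F) :
    T'.IsFlow (surgeryFlow F v₁ v₂ v₄ v₅) where
  antisymm := hF.surgeryFlow_swap v₁ v₂ v₄ v₅
  equilibrium x := by rw [sum_surgeryFlow, hF.equilibrium]
  zero a b hab := by
    have hswap : ∀ x y, surgeryFlow F v₁ v₂ v₄ v₅ x y = 0 → ∀ a b, s(a, b) = s(x, y) →
        surgeryFlow F v₁ v₂ v₄ v₅ a b = 0 := by
      intro x y hxy a b he
      rcases Sym2.eq_iff.1 he with ⟨rfl, rfl⟩ | ⟨rfl, rfl⟩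
      · exact hxy
      · simpa [hxy] using hF.surgeryFlow_swap v₁ v₂ v₄ v₅ a b
    by_cases h14 : s(a, b) = s(v₁, v₄)
    · exact hswap _ _ h.surgeryFlow₁₄ _ _ h14
    by_cases h25 : s(a, b) = s(v₂, v₅)
    · exact hswap _ _ h.surgeryFlow₂₅ _ _ h25
    have hn := h.nodup
    simp only [List.nodup_cons, List.mem_cons, List.not_mem_nil, or_false, not_or,
      not_false_eq_true, List.nodup_nil, and_true] at hn
    rw [h.adj_iff] at hab
    have hab' : ¬ T.graph.Adj a b := by tauto
    rw [surgeryFlow_of_ne F h14 h25 (by tauto) (by tauto), hF.zero _ _ hab']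
    intro h12
    rw [← SimpleGraph.mem_edgeSet, h12] at hab'
    exact hab' h.adj₁₂

theorem leafForce_surgeryFlow (h : IsSurgeryAt T T' v₁ v₂ v₃ v₄ v₅ v₆) (hF : T.IsFlow F) :
    ResolutionScheme.leafForce (surgeryFlow F v₁ v₂ v₄ v₅) = ResolutionScheme.leafForce F := by
  have key : ∀ {T : BinaryTree E I} {F : E ⊕ I → E ⊕ I → TwoForm}, T.IsFlow F → ∀ e,
      ResolutionScheme.leafForce F e = - ∑ b, F (Sum.inl e) b := fun hF e => by
    rw [ResolutionScheme.leafForce, ← Finset.sum_neg_distrib]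
    exact Finset.sum_congr rfl fun b _ => hF.swap _ _
  ext1 e
  rw [key (h.isFlow hF), key hF, sum_surgeryFlow]

end IsSurgeryAt

end Surgery

end BinaryTree

/-! ### Monodromies of framed cycles -/

/-- If `z` were nonzero, then `q` and `z` would be independent, as `g` separates them, and would
span both planes. -/
theorem line_inf_eq {A B : Submodule ℝ (Fin 3 → ℝ)} (hA : Module.finrank ℝ A = 2)
    (hB : Module.finrank ℝ B = 2) (hne : A ≠ B) {g : Module.Dual ℝ (Fin 3 → ℝ)}
    {q z : Fin 3 → ℝ} (hqA : q ∈ A) (hqB : q ∈ B) (hq : g q ≠ 0) (hzA : z ∈ A) (hzB : z ∈ B)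
    (hz : g z = 0) : z = 0 := by
  by_contra hz0
  have hli : LinearIndependent ℝ ![q, z] := by
    rw [LinearIndependent.pair_iff]
    intro s t h
    have hs : s = 0 := by
      have := congrArg g h
      simpa [hz, hq] using this
    subst hs
    simpa [hz0] using h
  have h2 := finrank_span_pair hli
  have hle : ∀ {C : Submodule ℝ (Fin 3 → ℝ)}, q ∈ C → z ∈ C → Module.finrank ℝ C = 2 →
      Submodule.span ℝ {q, z} = C := fun hq hz hC =>
    Submodule.eq_of_le_of_finrank_eq (Submodule.span_le.2 (by
      rintro x (rfl | rfl)
      · exact hq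
      · exact hz)) (by rw [h2, hC])
  exact hne ((hle hqA hzA hA).symm.trans (hle hqB hzB hB))

/-- The shift operator is induced by a projection of `ℝ³` along `e ∩ ℓ`. -/
theorem shift_span {ℓ e m : Submodule ℝ (Fin 3 → ℝ)} {g φ ψ : Module.Dual ℝ (Fin 3 → ℝ)}
    (hℓ : ℓ = LinearMap.ker g) (he : e = LinearMap.ker φ) (hm : m = LinearMap.ker ψ)
    (hg : g ≠ 0) (hφ : φ ≠ 0) (hψ : ψ ≠ 0) (hne : e ≠ m) {q : Fin 3 → ℝ} (hqe : q ∈ e)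
    (hqm : q ∈ m) (hq : g q ≠ 0) (x : Fin 3 → ℝ) :
    ∃ y, y ∈ m ∧ g y = g x ∧ φ y = φ x ∧
      shift ℓ e m (Submodule.span ℝ {x}) = Submodule.span ℝ {y} := by
  subst hℓ he hm
  -- The vector `a` represents the point `e ∩ ℓ`; it exists because two planes in ℝ³ meet
  -- nontrivially.
  obtain ⟨a, ha, ha0⟩ : ∃ a, a ∈ LinearMap.ker φ ⊓ LinearMap.ker g ∧ a ≠ 0 := by
    rw [← Submodule.ne_bot_iff]
    intro h
    have h1 := Submodule.finrank_sup_add_finrank_inf_eq (LinearMap.ker φ) (LinearMap.ker g)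
    have h2 := Submodule.finrank_le (LinearMap.ker φ ⊔ LinearMap.ker g)
    rw [h, finrank_ker_dual hφ, finrank_ker_dual hg, finrank_bot] at h1
    simp at h2
    omega
  have hspan : LinearMap.ker φ ⊓ LinearMap.ker g = Submodule.span ℝ {a} := by
    refine le_antisymm (fun z hz => ?_) (by simpa using ha)
    have hne' : LinearMap.ker φ ≠ LinearMap.ker g := fun h => hq (by
      rw [h] at hqe
      exact hqe)
    obtain ⟨v, hv⟩ : ∃ v : Module.Dual ℝ (Fin 3 → ℝ), v a ≠ 0 := by
      by_contra! h
      exact ha0 ((Module.forall_dual_apply_eq_zero_iff ℝ a).1 h)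
    have h0 : z - (v z / v a) • a = 0 := by
      refine line_inf_eq (finrank_ker_dual hφ) (finrank_ker_dual hg) hne' ha.1 ha.2 hv
        (Submodule.sub_mem _ hz.1 (Submodule.smul_mem _ _ ha.1))
        (Submodule.sub_mem _ hz.2 (Submodule.smul_mem _ _ ha.2)) ?_
      simp [hv]
    exact Submodule.mem_span_singleton.2 ⟨_, (sub_eq_zero.1 h0).symm⟩
  have hψa : ψ a ≠ 0 := fun h => ha0 (line_inf_eq (finrank_ker_dual hφ) (finrank_ker_dual hψ) hne
    hqe hqm hq ha.1 h ha.2)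
  have hφa : φ a = 0 := ha.1
  have hga : g a = 0 := ha.2
  have hy : ψ (x - (ψ x / ψ a) • a) = 0 := by simp [hψa]
  -- Project `x` to `m` along `a`. As `g` and `φ` both kill `a`, neither value changes.
  refine ⟨x - (ψ x / ψ a) • a, hy, by simp [hga], by simp [hφa], ?_⟩
  rw [shift, hspan, ← Submodule.span_insert]
  refine le_antisymm ?_ ?_
  · rintro z ⟨hz, hz'⟩
    obtain ⟨s, t, rfl⟩ := Submodule.mem_span_pair.1 hz'
    have h0 : s * ψ a + t * ψ x = 0 := by simpa using hz
    refine Submodule.mem_span_singleton.2 ⟨t, ?_⟩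
    have hs : s = - (t * (ψ x / ψ a)) := by
      field_simp
      linarith
    rw [hs]
    module
  · rw [Submodule.span_singleton_le_iff_mem]
    refine ⟨hy, Submodule.mem_span_pair.2 ⟨- (ψ x / ψ a), 1, ?_⟩⟩
    module

/-- A framed cycle with functionals `φ t` on the edge lines, such that `φ (t + 1) = r t • φ t` on
the framing line at `t + 1`. -/
structure IsFramedBy {k : ℕ} (p : ZMod k → Point) (L : ZMod k → ProjLine)
    (φ : ZMod k → Module.Dual ℝ (Fin 3 → ℝ)) (r : ZMod k → ℝ) : Prop where
  join_eq : ∀ t, join (p t) (p (t + 1)) = LinearMap.ker (φ t)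
  ne_zero : ∀ t, φ t ≠ 0
  mem : ∀ t, (p t).submodule ≤ (L t).1
  ne : ∀ t, join (p t) (p (t + 1)) ≠ (L t).1
  ne' : ∀ t, join (p t) (p (t + 1)) ≠ (L (t + 1)).1
  scale : ∀ t, ∀ x ∈ (L (t + 1)).1, φ (t + 1) x = r t * φ t x

theorem ProjLine.exists_ker (L : ProjLine) : ∃ g : Module.Dual ℝ (Fin 3 → ℝ),
    g ≠ 0 ∧ L.1 = LinearMap.ker g := by
  obtain ⟨p, q, hli, hspan⟩ := exists_span_pair_eq L.2
  have hne : form (dWedge p q) ≠ 0 := fun h => form_dWedge_eq_zero.1 h hli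
  refine ⟨_, hne, Submodule.eq_of_le_of_finrank_eq (hspan ▸ span_le_ker_form p q) ?_⟩
  rw [L.2, finrank_ker_dual hne]

theorem submodule_le_iff {p : Point} {W : Submodule ℝ (Fin 3 → ℝ)} :
    p.submodule ≤ W ↔ p.rep ∈ W := by
  rw [p.submodule_eq, Submodule.span_singleton_le_iff_mem]

namespace IsFramedBy

variable {k : ℕ} {p : ZMod k → Point} {L : ZMod k → ProjLine}
  {φ : ZMod k → Module.Dual ℝ (Fin 3 → ℝ)} {r : ZMod k → ℝ}

/-- Working with vectors instead of points keeps track of scale: each shift preserves `g` and the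
current `φ`, and passing to the next `φ` on the new framing line costs the factor `r`. -/
theorem shiftAlong_span (h : IsFramedBy p L φ r) {ℓ : ProjLine} {g : Module.Dual ℝ (Fin 3 → ℝ)}
    (hg : g ≠ 0) (hℓ : ℓ.1 = LinearMap.ker g) (hp : ∀ t, ¬ (p t).submodule ≤ ℓ.1) (i : ZMod k)
    {x : Fin 3 → ℝ} (hx : x ∈ (L i).1) (s : ℕ) :
    ∃ y ∈ (L (i + s)).1, g y = g x ∧
      φ (i + s) y = (∏ u ∈ Finset.range s, r (i + u)) * φ i x ∧
      shiftAlong p L ℓ i s (Submodule.span ℝ {x}) = Submodule.span ℝ {y} := by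
  induction s with
  | zero => exact ⟨x, by simpa using hx, rfl, by simp, rfl⟩
  | succ s ih =>
    obtain ⟨y, hy, hgy, hφy, hsy⟩ := ih
    obtain ⟨ψ, hψ, hLψ⟩ := (L (i + s + 1)).exists_ker
    obtain ⟨z, hz, hgz, hφz, hsz⟩ := shift_span hℓ (h.join_eq (i + s)) hLψ hg (h.ne_zero _) hψ
      (h.ne' (i + s)) (q := (p (i + s + 1)).rep)
      (submodule_le_iff.1 le_sup_right) (submodule_le_iff.1 (h.mem _))
      (fun h0 => hp (i + s + 1) (submodule_le_iff.2 (by rw [hℓ]; exact h0))) y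
    have e : i + ((s + 1 : ℕ) : ZMod k) = i + s + 1 := by
      push_cast
      ring
    rw [e]
    refine ⟨z, hz, hgz.trans hgy, ?_, ?_⟩
    · rw [h.scale _ z hz, hφz, hφy, Finset.prod_range_succ]
      ring
    · rw [shiftAlong, hsy, hsz]

/-- On the framing line, `g` and `φ i` are independent coordinates: `φ i` vanishes at the cycle
point and `g` does not. -/
theorem eq_zero_of_mem (h : IsFramedBy p L φ r) {ℓ : ProjLine} {g : Module.Dual ℝ (Fin 3 → ℝ)}
    (hℓ : ℓ.1 = LinearMap.ker g) (hp : ∀ t, ¬ (p t).submodule ≤ ℓ.1) (i : ZMod k)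
    {x : Fin 3 → ℝ} (hx : x ∈ (L i).1) (hgx : g x = 0) (hφx : φ i x = 0) : x = 0 := by
  have hne := h.ne i
  have hj := h.join_eq i
  refine line_inf_eq (A := join (p i) (p (i + 1))) (q := (p i).rep) ?_ (L i).2 hne
    (submodule_le_iff.1 le_sup_left) (submodule_le_iff.1 (h.mem i))
    (fun h0 => hp i (submodule_le_iff.2 (by rw [hℓ]; exact h0))) (by rw [hj]; exact hφx) hx hgx
  rw [hj, finrank_ker_dual (h.ne_zero i)]

theorem trivialMonodromy (h : IsFramedBy p L φ fun _ => 1) : TrivialMonodromy p L := by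
  intro ℓ hp i x hx
  obtain ⟨g, hg, hℓ⟩ := ℓ.exists_ker
  have hx' := submodule_le_iff.1 hx
  obtain ⟨y, hy, hgy, hφy, hs⟩ := h.shiftAlong_span hg hℓ hp i hx' k
  have e : i + (k : ZMod k) = i := by simp
  rw [e] at hy hφy
  have : y - x.rep = 0 := h.eq_zero_of_mem hℓ hp i (Submodule.sub_mem _ hy hx')
    (by simp [hgy]) (by simp [hφy])
  rw [monodromy, x.submodule_eq, hs, sub_eq_zero.1 this]

theorem prod_eq_one [NeZero k] (h : IsFramedBy p L φ r) (hL : TrivialMonodromy p L) (i : ZMod k) :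
    ∏ u ∈ Finset.range k, r (i + u) = 1 := by
  obtain ⟨g, hg⟩ := Module.exists_dual_forall_apply_ne_zero (K := ℝ)
    (fun t => (p t).rep) (fun t => (p t).rep_nonzero)
  have hg0 : g ≠ 0 := by
    rintro rfl
    exact hg i rfl
  let ℓ : ProjLine := ⟨LinearMap.ker g, finrank_ker_dual hg0⟩
  have hp : ∀ t, ¬ (p t).submodule ≤ ℓ.1 := fun t ht => hg t (submodule_le_iff.1 ht)
  obtain ⟨y, hyL, hy⟩ : ∃ y ∈ (L i).1, φ i y ≠ 0 := by
    by_contra! hc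
    refine h.ne i (Submodule.eq_of_le_of_finrank_eq (S₂ := join (p i) (p (i + 1))) (fun y hy => ?_)
      ?_).symm
    · rw [h.join_eq]
      exact hc y hy
    · rw [(L i).2, h.join_eq, finrank_ker_dual (h.ne_zero i)]
  have hqL := submodule_le_iff.1 (h.mem i)
  have hφq : φ i (p i).rep = 0 := by
    have : (p i).rep ∈ LinearMap.ker (φ i) := by
      rw [← h.join_eq]
      exact submodule_le_iff.1 le_sup_left
    exact this
  -- A test vector with both coordinates nonzero: adding the cycle point, if necessary, corrects `g`
  -- without changing `φ i`.
  obtain ⟨x, hxL, hgx, hφx⟩ : ∃ x ∈ (L i).1, g x ≠ 0 ∧ φ i x ≠ 0 := by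
    by_cases hgy : g y = 0
    · exact ⟨y + (p i).rep, Submodule.add_mem _ hyL hqL, by simpa [hgy] using hg i,
        by simpa [hφq] using hy⟩
    · exact ⟨y, hyL, hgy, hy⟩
  have hx0 : x ≠ 0 := by
    rintro rfl
    simp at hgx
  obtain ⟨z, hz, hgz, hφz, hs⟩ := h.shiftAlong_span (ℓ := ℓ) hg0 rfl hp i hxL k
  have e : i + (k : ZMod k) = i := by simp
  rw [e] at hφz
  have hm := hL ℓ hp i (Projectivization.mk ℝ x hx0) (by
    rw [Projectivization.submodule_mk, Submodule.span_singleton_le_iff_mem]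
    exact hxL)
  rw [monodromy, Projectivization.submodule_mk, hs] at hm
  obtain ⟨c, rfl⟩ : ∃ c : ℝ, c • x = z := Submodule.mem_span_singleton.1
    (hm ▸ Submodule.mem_span_singleton_self z)
  -- A fixed projective point gives `z = c • x`. Preservation of `g` forces `c = 1`, and comparing
  -- `φ i` then yields the product.
  have hc : c = 1 := by
    rw [map_smul, smul_eq_mul] at hgz
    exact mul_right_cancel₀ hgx (by rw [hgz, one_mul])
  rw [hc, one_smul] at hφz
  exact (mul_right_cancel₀ hφx (by rw [one_mul, ← hφz])).symm

end IsFramedBy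

/-! ### Potentials on graphs -/

section Potential

variable {V : Type*} {G : SimpleGraph V}

/-- The product of a function on darts along a walk. -/
def walkProd (r : V → V → ℝ) : ∀ {u v : V}, G.Walk u v → ℝ
  | _, _, .nil => 1
  | u, _, .cons (v := w) _ p => r u w * walkProd r p

@[simp] theorem walkProd_nil (r : V → V → ℝ) (u : V) :
    walkProd r (SimpleGraph.Walk.nil : G.Walk u u) = 1 := rfl

@[simp] theorem walkProd_cons (r : V → V → ℝ) {u v w : V} (h : G.Adj u v) (p : G.Walk v w) :
    walkProd r (SimpleGraph.Walk.cons h p) = r u v * walkProd r p := rfl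

theorem walkProd_append (r : V → V → ℝ) {u v w : V} (p : G.Walk u v) (q : G.Walk v w) :
    walkProd r (p.append q) = walkProd r p * walkProd r q := by
  induction p with
  | nil => simp
  | cons h p ih => simp [ih, mul_assoc]

theorem walkProd_eq_prod (r : V → V → ℝ) {u v : V} (p : G.Walk u v) :
    walkProd r p = ∏ i ∈ Finset.range p.length, r (p.getVert i) (p.getVert (i + 1)) := by
  induction p with
  | nil => simp
  | cons h p ih =>
    rw [walkProd_cons, SimpleGraph.Walk.length_cons, Finset.prod_range_succ', ih, mul_comm]
    simp

/-- The second part handles the wrap-around: index `w.length` becomes `0` in `ZMod w.length`, and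
both indices give the base point of the walk. -/
theorem IsCycle.isSimpleCycle {v : V} {w : G.Walk v v} (hw : w.IsCycle) :
    IsSimpleCycle G (fun t : ZMod w.length => w.getVert t.val) ∧
      ∀ u < w.length, w.getVert ((u + 1 : ZMod w.length)).val = w.getVert (u + 1) := by
  have h3 := hw.three_le_length
  have : NeZero w.length := ⟨by omega⟩
  have : Fact (1 < w.length) := ⟨by omega⟩
  have hsucc : ∀ u < w.length,
      w.getVert ((u + 1 : ZMod w.length)).val = w.getVert (u + 1) := by
    intro u hu
    have e : ((u : ZMod w.length) + 1).val = (u + 1) % w.length := by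
      rw [← Nat.cast_succ, ZMod.val_natCast]
    rw [e]
    rcases Nat.lt_or_ge (u + 1) w.length with h | h
    · rw [Nat.mod_eq_of_lt h]
    · have : u + 1 = w.length := by omega
      rw [this, Nat.mod_self, SimpleGraph.Walk.getVert_zero, SimpleGraph.Walk.getVert_length]
  refine ⟨⟨h3, fun s t hst => ?_, fun t => ?_⟩, hsucc⟩
  · have hs := ZMod.val_lt s
    have ht := ZMod.val_lt t
    exact ZMod.val_injective _ (hw.getVert_injOn' (by simp; omega) (by simp; omega) hst)
  · have h := hsucc t.val (ZMod.val_lt t)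
    rw [ZMod.natCast_zmod_val] at h
    simp only [h]
    exact w.adj_getVert_succ (ZMod.val_lt t)

variable {r : V → V → ℝ}

/-- Making a walk into a path cuts out closed walks no longer than the walk itself, and each of
these contributes the factor `1`. -/
theorem walkProd_bypass [DecidableEq V] {u v : V} (p : G.Walk u v)
    (h : ∀ (x : V) (c : G.Walk x x), c.length ≤ p.length → walkProd r c = 1) :
    walkProd r p = walkProd r p.bypass := by
  induction p with
  | nil => rfl
  | @cons u w v hadj p ih =>
    have ih := ih fun x c hc => h x c (hc.trans (Nat.le_succ _))
    rw [walkProd_cons, ih, SimpleGraph.Walk.bypass]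
    split_ifs with hs
    · have h1 := h _ (SimpleGraph.Walk.cons hadj (p.bypass.takeUntil u hs)) (by
        rw [SimpleGraph.Walk.length_cons, SimpleGraph.Walk.length_cons]
        exact Nat.succ_le_succ
          ((p.bypass.length_takeUntil_le_length hs).trans p.length_bypass_le_length))
      rw [walkProd_cons] at h1
      conv_lhs => rw [← p.bypass.take_spec hs]
      rw [walkProd_append, ← mul_assoc, h1, one_mul]
    · rfl

/-- Strong induction on the length. A closed walk that is not a simple cycle or a back-and-forth
step reduces to shorter closed walks; a Hamiltonian cycle is split by a chord, which exists because
degrees are at least `3`. -/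
theorem walkProd_eq_one [Fintype V] [DecidableRel G.Adj] (hdeg : ∀ v, 3 ≤ G.degree v)
    (hr : ∀ u v, G.Adj u v → r u v * r v u = 1)
    (hcycle : ∀ (k : ℕ) (q : ZMod k → V), IsSimpleCycle G q → k < Fintype.card V →
      ∏ u ∈ Finset.range k, r (q u) (q (u + 1)) = 1) {v : V} (w : G.Walk v v) :
    walkProd r w = 1 := by
  classical
  suffices H : ∀ n (v : V) (w : G.Walk v v), w.length = n → walkProd r w = 1 from H _ v w rfl
  intro n
  induction n using Nat.strong_induction_on with
  | _ n ih =>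
    rintro v w rfl
    cases w with
    | nil => rfl
    | @cons _ u _ h p =>
      rw [SimpleGraph.Walk.length_cons] at ih
      have hb := walkProd_bypass (r := r) p fun x c hc => ih _ (Nat.lt_succ_of_le hc) x c rfl
      rw [walkProd_cons, hb]
      have hle := p.length_bypass_le_length
      have hpath := p.bypass_isPath
      generalize p.bypass = p' at *
      by_cases hlt : p'.length < p.length
      · have := ih (p'.length + 1) (by omega) v (SimpleGraph.Walk.cons h p') rfl
        rwa [walkProd_cons] at this
      have hlen : p'.length = p.length := by omega
      rw [← hlen] at ih
      clear hb hle hlt hlen p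
      rename' p' => p
      by_cases h2 : 2 ≤ p.length
      · have hcyc : (SimpleGraph.Walk.cons h p).IsCycle := by
          refine (SimpleGraph.Walk.cons_isCycle_iff p h).2 ⟨hpath, fun he => ?_⟩
          have h1 := hpath.length_eq_one_of_mem_edges (Sym2.eq_swap ▸ he)
          omega
        rcases Nat.lt_or_ge (p.length + 1) (Fintype.card V) with hk | hk
        · obtain ⟨hs, hsucc⟩ := IsCycle.isSimpleCycle hcyc
          have := hcycle _ _ hs hk
          rw [← walkProd_cons r h p, walkProd_eq_prod, ← this]
          refine Finset.prod_congr rfl fun i hi => ?_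
          rw [Finset.mem_range] at hi
          rw [hsucc i hi, ZMod.val_natCast_of_lt hi]
        · have hall : ∀ x, x ∈ p.support := by
            intro x
            have hcard : p.support.toFinset.card = Fintype.card V := by
              refine le_antisymm (Finset.card_le_univ _) ?_
              rw [List.toFinset_card_of_nodup hpath.support_nodup,
                SimpleGraph.Walk.length_support]
              exact hk
            have := Finset.card_eq_iff_eq_univ _ |>.1 hcard
            exact List.mem_toFinset.1 (this ▸ Finset.mem_univ x)
          -- The cycle uses only two edges at `v`, towards `u` and towards `p.penultimate`; a third
          -- neighbour gives a chord `vx`.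
          obtain ⟨x, hvx, hxu, hxp⟩ : ∃ x, G.Adj v x ∧ x ≠ u ∧ x ≠ p.penultimate := by
            by_contra! hc
            have hsub : G.neighborFinset v ⊆ {u, p.penultimate} := fun x hx => by
              rw [SimpleGraph.mem_neighborFinset] at hx
              have := hc x hx
              rw [Finset.mem_insert, Finset.mem_singleton]
              tauto
            have h1 := Finset.card_le_card hsub
            have h2 := Finset.card_le_two (a := u) (b := p.penultimate)
            have h3 := hdeg v
            rw [← SimpleGraph.card_neighborFinset_eq_degree] at h3
            omega
          have hx := hall x
          have hspec := p.take_spec hx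
          have hlen := congrArg SimpleGraph.Walk.length hspec
          rw [SimpleGraph.Walk.length_append] at hlen
          have htake : 0 < (p.takeUntil x hx).length := by
            rw [Nat.pos_iff_ne_zero]
            exact fun h0 => hxu (SimpleGraph.Walk.eq_of_length_eq_zero h0).symm
          have hdrop : 2 ≤ (p.dropUntil x hx).length := by
            have hpen : (p.dropUntil x hx).length ≠ 0 → (p.dropUntil x hx).length ≠ 1 := by
              intro _ h1
              apply hxp
              rw [← hspec]
              cases hd : p.dropUntil x hx with
              | nil => simp [hd] at h1
              | cons ha q =>
                cases q with
                | nil => simp [SimpleGraph.Walk.penultimate, SimpleGraph.Walk.getVert_append]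
                | cons hb q' => simp [hd] at h1
            have h0 : (p.dropUntil x hx).length ≠ 0 := fun h0 =>
              hvx.ne (SimpleGraph.Walk.eq_of_length_eq_zero h0).symm
            have := hpen h0
            omega
          -- The chord cuts the cycle into two closed walks. They are shorter since `x ≠ u` and `x ≠
          -- p.penultimate`, and their products multiply to the original one because the chord is
          -- traversed once in each direction.
          have e1 := ih _ (by
              rw [SimpleGraph.Walk.length_cons, SimpleGraph.Walk.length_append,
                SimpleGraph.Walk.length_cons, SimpleGraph.Walk.length_nil]
              omega) v
            (SimpleGraph.Walk.cons h ((p.takeUntil x hx).append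
              (SimpleGraph.Walk.cons hvx.symm SimpleGraph.Walk.nil))) rfl
          have e2 := ih _ (by
              rw [SimpleGraph.Walk.length_cons]
              omega) v
            (SimpleGraph.Walk.cons hvx (p.dropUntil x hx)) rfl
          have e3 := hr v x hvx
          rw [← hspec, walkProd_append]
          simp only [walkProd_cons, walkProd_append, walkProd_nil, mul_one] at e1 e2
          have hne : r v x ≠ 0 := left_ne_zero_of_mul_eq_one e3
          calc _ = (r v u * (walkProd r (p.takeUntil x hx) * r x v)) *
                (r v x * walkProd r (p.dropUntil x hx)) := by
                  linear_combination (- r v u * walkProd r (p.takeUntil x hx) *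
                    walkProd r (p.dropUntil x hx)) * e3
            _ = 1 := by rw [e1, e2, one_mul]
      · cases p with
        | nil => exact absurd h (G.loopless.irrefl _)
        | cons h' p =>
          cases p with
          | nil => simpa using hr v u h
          | cons h'' p =>
            simp at h2

/-- A function on darts is a coboundary if its products along the non-Hamiltonian simple cycles
are trivial. -/
theorem exists_potential [Fintype V] [DecidableRel G.Adj] (hG : G.Connected)
    (hdeg : ∀ v, 3 ≤ G.degree v) (hr : ∀ u v, G.Adj u v → r u v * r v u = 1)
    (hcycle : ∀ (k : ℕ) (q : ZMod k → V), IsSimpleCycle G q → k < Fintype.card V →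
      ∏ u ∈ Finset.range k, r (q u) (q (u + 1)) = 1) :
    ∃ c : V → ℝ, (∀ v, c v ≠ 0) ∧ ∀ u v, G.Adj u v → c v = c u * r u v := by
  obtain ⟨o⟩ := hG.nonempty
  choose w hw using fun v => (hG.preconnected o v).exists_isPath
  have hclosed := fun v (w : G.Walk v v) => walkProd_eq_one hdeg hr hcycle w
  have hback : ∀ v, walkProd r (w v) * walkProd r (w v).reverse = 1 := fun v => by
    rw [← walkProd_append, hclosed]
  -- The potential at `v` is the product along a chosen path from the base point `o`; closed walks
  -- having product `1` makes it compatible with every edge.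
  refine ⟨fun v => walkProd r (w v), fun v => left_ne_zero_of_mul_eq_one (hback v), ?_⟩
  intro u v huv
  have h1 := hclosed o (((w u).append (SimpleGraph.Walk.cons huv SimpleGraph.Walk.nil)).append
    (w v).reverse)
  simp only [walkProd_append, walkProd_cons, walkProd_nil, mul_one] at h1
  exact mul_right_cancel₀ (right_ne_zero_of_mul_eq_one (hback v)) ((hback v).trans h1.symm)

end Potential

/-! ### Existence of binary trees -/

section Caterpillar

variable {E : Type*} {m : ℕ} (e : E ≃ Fin (m + 3))

/-- A path with `m + 1` inner vertices and `m + 3` leaves attached to them. -/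
def caterpillar : SimpleGraph (E ⊕ Fin (m + 1)) where
  Adj
    | .inl _, .inl _ => False
    -- Truncated subtraction and `min` attach the leaves `0`, `1` to the first inner vertex and `m +
    -- 1`, `m + 2` to the last one.
    | .inl l, .inr x => (x : ℕ) = min ((e l : ℕ) - 1) m
    | .inr x, .inl l => (x : ℕ) = min ((e l : ℕ) - 1) m
    | .inr x, .inr y => (x : ℕ) + 1 = y ∨ (y : ℕ) + 1 = x
  symm := ⟨by
    rintro (l | x) (l' | y) h
    · exact h
    · exact h
    · exact h
    · exact Or.symm h⟩
  loopless := ⟨by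
    rintro (l | x) h
    · exact h
    · rcases h with h | h <;> omega⟩

theorem caterpillar_connected : (caterpillar e).Connected := by
  have h1 : ∀ n (hn : n < m + 1), (caterpillar e).Reachable (Sum.inr ⟨n, hn⟩)
      (Sum.inr ⟨0, Nat.succ_pos m⟩) := by
    intro n
    induction n with
    | zero => exact fun _ => SimpleGraph.Reachable.refl _
    | succ n ih =>
      intro hn
      refine SimpleGraph.Reachable.trans (SimpleGraph.Adj.reachable ?_) (ih (by omega))
      exact Or.inr rfl
  have h2 : ∀ v, (caterpillar e).Reachable v (Sum.inr ⟨0, Nat.succ_pos m⟩) := by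
    rintro (l | x)
    · refine SimpleGraph.Reachable.trans (SimpleGraph.Adj.reachable ?_)
        (h1 (min ((e l : ℕ) - 1) m) (by omega))
      exact rfl
    · exact h1 x x.2
  have : Nonempty (E ⊕ Fin (m + 1)) := ⟨Sum.inr 0⟩
  exact SimpleGraph.Connected.mk fun a b => (h2 a).trans (h2 b).symm

theorem caterpillar_degree_leaf (l : E) :
    ((caterpillar e).neighborSet (Sum.inl l)).encard = 1 := by
  rw [Set.encard_eq_one]
  refine ⟨Sum.inr ⟨min ((e l : ℕ) - 1) m, by omega⟩, ?_⟩
  ext (l' | y)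
  · simp [caterpillar]
  · simp [caterpillar, Fin.ext_iff]

theorem caterpillar_degree_inner (x : Fin (m + 1)) :
    ((caterpillar e).neighborSet (Sum.inr x)).encard = 3 := by
  have hx := x.2
  rw [Set.encard_eq_three]
  -- Neighbours of `x`: on the left the previous inner vertex or leaf `0`, then its own leaf `x +
  -- 1`, and on the right the next inner vertex or leaf `m + 2`.
  let a : E ⊕ Fin (m + 1) := if (x : ℕ) = 0 then Sum.inl (e.symm ⟨0, by omega⟩) else
    Sum.inr ⟨x - 1, by omega⟩
  let b : E ⊕ Fin (m + 1) := Sum.inl (e.symm ⟨x + 1, by omega⟩)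
  let c : E ⊕ Fin (m + 1) := if h : (x : ℕ) = m then Sum.inl (e.symm ⟨m + 2, by omega⟩) else
    Sum.inr ⟨x + 1, by omega⟩
  refine ⟨a, b, c, ?_, ?_, ?_, ?_⟩
  · simp only [a, b]
    split_ifs <;> simp only [ne_eq, Sum.inl.injEq, EmbeddingLike.apply_eq_iff_eq, Fin.mk.injEq,
      reduceCtorEq, not_false_eq_true]
  · simp only [a, c]
    split_ifs <;> simp only [ne_eq, Sum.inl.injEq, Sum.inr.injEq, EmbeddingLike.apply_eq_iff_eq,
      Fin.mk.injEq, reduceCtorEq, not_false_eq_true] <;> omega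
  · simp only [b, c]
    split_ifs <;> simp only [ne_eq, Sum.inl.injEq, EmbeddingLike.apply_eq_iff_eq, Fin.mk.injEq,
      reduceCtorEq, not_false_eq_true] <;> omega
  · ext (l | y)
    · have hl := (e l).2
      simp only [a, b, c, SimpleGraph.mem_neighborSet, Set.mem_insert_iff, Set.mem_singleton_iff,
        caterpillar]
      split_ifs <;> simp only [Sum.inl.injEq, Equiv.eq_symm_apply, Fin.ext_iff, or_false,
        false_or] <;> omega
    · have hy := y.2
      simp only [a, b, c, SimpleGraph.mem_neighborSet, Set.mem_insert_iff, Set.mem_singleton_iff,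
        caterpillar]
      split_ifs <;> simp [Fin.ext_iff] <;> omega

theorem exists_binaryTree {E : Type*} [Fintype E] (h : 3 ≤ Fintype.card E) :
    ∃ (I : Type) (_ : Fintype I), Nonempty (BinaryTree E I) := by
  obtain ⟨m, hm⟩ := Nat.exists_eq_add_of_le' h
  let e : E ≃ Fin (m + 3) := Fintype.equivFinOfCardEq hm
  refine ⟨Fin (m + 1), inferInstance, ⟨⟨caterpillar e, ?_, caterpillar_degree_leaf e,
    caterpillar_degree_inner e⟩⟩⟩
  exact BinaryTree.isTree_of_connected (caterpillar_connected e) (caterpillar_degree_leaf e)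
    (caterpillar_degree_inner e) (by simp [hm])

end Caterpillar

/-! ### Resolution schemes of vertex systems -/

theorem exists_ne_ne_of_card {E : Type*} [Fintype E] (h : 3 ≤ Fintype.card E) (j k : E) :
    ∃ l, l ≠ j ∧ l ≠ k := by
  classical
  by_contra! hc
  have hsub : (Finset.univ : Finset E) ⊆ {j, k} := fun x _ => by
    have := hc x
    rw [Finset.mem_insert, Finset.mem_singleton]
    tauto
  have := (Finset.card_le_card hsub).trans Finset.card_le_two
  rw [Finset.card_univ] at this
  omega

namespace NonParallelizableSystem

variable {E : Type*} [Fintype E] {f : E → TwoForm}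

theorem ne_zero (hf : NonParallelizableSystem f) (hE : 3 ≤ Fintype.card E) (j : E) : f j ≠ 0 := by
  obtain ⟨l, hl, -⟩ := exists_ne_ne_of_card hE j j
  intro h
  rcases hf.sum_eq_zero {j} (by simpa using h) with h | h
  · simp at h
  · have : l ∈ ({j} : Finset E) := h ▸ Finset.mem_univ l
    simp [hl] at this

theorem add_ne_zero (hf : NonParallelizableSystem f) (hE : 3 ≤ Fintype.card E) {j k : E}
    (hjk : j ≠ k) : f j + f k ≠ 0 := by
  classical
  obtain ⟨l, hl, hl'⟩ := exists_ne_ne_of_card hE j k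
  intro h
  rcases hf.sum_eq_zero {j, k} (by rwa [Finset.sum_pair hjk]) with h | h
  · simp at h
  · have : l ∈ ({j, k} : Finset E) := h ▸ Finset.mem_univ l
    simp [hl, hl'] at this

/-- A third index keeps `{j, k}` proper, so condition (b) applies. It is what makes edge lines
differ from framing lines. -/
theorem ker_ne (hf : NonParallelizableSystem f) (hE : 3 ≤ Fintype.card E) {j k : E}
    (hjk : j ≠ k) : LinearMap.ker (form (f j)) ≠ LinearMap.ker (form (f j + f k)) := by
  classical
  obtain ⟨l, hl, hl'⟩ := exists_ne_ne_of_card hE j k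
  refine hf.lines_distinct j {j} {j, k} (by simp) (by simp) (fun h => ?_) (fun h => ?_)
    (fun h => ?_) _ _ ?_ ?_
  · have : l ∈ ({j} : Finset E) := h ▸ Finset.mem_univ l
    simp [hl] at this
  · have : l ∈ ({j, k} : Finset E) := h ▸ Finset.mem_univ l
    simp [hl, hl'] at this
  · have : k ∈ ({j} : Finset E) := h ▸ (by simp)
    simp [hjk.symm] at this
  · rw [Finset.sum_singleton]
    exact isLineOfForce_ker (hf.ne_zero hE j)
  · rw [Finset.sum_pair hjk]
    exact isLineOfForce_ker (hf.add_ne_zero hE hjk)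

end NonParallelizableSystem

/-- A non-parallelizable system of forces through `p` with zero sum. -/
structure IsVertexSystem {E : Type*} [Fintype E] (p : Point) (f : E → TwoForm) : Prop where
  nonParallelizable : NonParallelizableSystem f
  sum_eq_zero : ∑ e, f e = 0
  mem : ∀ e, p.submodule ≤ LinearMap.ker (form (f e))

namespace IsVertexSystem

variable {E I : Type*} [Fintype E] {p : Point} {f : E → TwoForm}

theorem le_ker_flow (hf : IsVertexSystem p f) (T : BinaryTree E I) (a b : E ⊕ I) :
    p.submodule ≤ LinearMap.ker (form (T.flow f a b)) := by
  intro x hx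
  rw [BinaryTree.flow]
  split_ifs
  · rw [LinearMap.mem_ker, map_sum, LinearMap.sum_apply]
    exact Finset.sum_eq_zero fun e _ => hf.mem e hx
  · simp

variable [Fintype I]

/-- Reversing a dart only changes the sign of the flow, so the line depends on the undirected edge
alone. -/
theorem exists_flow_line (hf : IsVertexSystem p f) (T : BinaryTree E I) (e : T.graph.edgeSet) :
    ∃ ℓ : ProjLine, ∀ a b, e.1 = s(a, b) → ℓ.1 = LinearMap.ker (form (T.flow f a b)) := by
  obtain ⟨⟨a, b⟩, he⟩ := e
  have hab : T.graph.Adj a b := he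
  refine ⟨lineOf _ (BinaryTree.flow_ne_zero hf.nonParallelizable hab), fun c d h => ?_⟩
  rcases Sym2.eq_iff.1 h with ⟨rfl, rfl⟩ | ⟨rfl, rfl⟩
  · rfl
  · rw [(BinaryTree.isFlow_flow hf.sum_eq_zero).swap a b, map_neg, LinearMap.ker_neg]
    rfl

/-- The resolution scheme on a given tree whose equilibrium force-load has given leaf forces. -/
def scheme (hf : IsVertexSystem p f) (T : BinaryTree E I) : ResolutionScheme E I p where
  tree := T
  line e := (hf.exists_flow_line T e).choose
  mem e := by
    obtain ⟨⟨a, b⟩, he⟩ := e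
    rw [(hf.exists_flow_line T ⟨s(a, b), he⟩).choose_spec a b rfl]
    exact hf.le_ker_flow T a b

theorem scheme_line (hf : IsVertexSystem p f) (T : BinaryTree E I) {a b : E ⊕ I}
    (h : s(a, b) ∈ T.graph.edgeSet) :
    ((hf.scheme T).line ⟨s(a, b), h⟩).1 = LinearMap.ker (form (T.flow f a b)) :=
  (hf.exists_flow_line T ⟨s(a, b), h⟩).choose_spec a b rfl

theorem scheme_line_leaf (hf : IsVertexSystem p f) (T : BinaryTree E I) {j : E}
    (e : T.graph.edgeSet) (h : Sum.inl j ∈ e.1) :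
    ((hf.scheme T).line e).1 = LinearMap.ker (form (f j)) := by
  obtain ⟨⟨a, b⟩, he⟩ := e
  have hab : T.graph.Adj a b := he
  have hflow := BinaryTree.isFlow_flow (T := T) hf.sum_eq_zero
  rw [← congrFun (BinaryTree.leafForce_flow (T := T) hf.sum_eq_zero) j]
  rcases Sym2.mem_iff.1 h with rfl | rfl
  · rw [hflow.leafForce_eq hab.symm, hflow.swap, map_neg, LinearMap.ker_neg]
    exact hf.scheme_line T he
  · rw [hflow.leafForce_eq hab]
    exact hf.scheme_line T he

theorem isEquilibrium_scheme (hf : IsVertexSystem p f) (T : BinaryTree E I) :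
    (hf.scheme T).IsEquilibrium (T.flow f) where
  along a b h := by
    rw [actsAlong_iff ((hf.scheme T).line _).2]
    exact (hf.scheme_line T h).le
  stress := (BinaryTree.isFlow_flow hf.sum_eq_zero).antisymm
  zero := (BinaryTree.isFlow_flow hf.sum_eq_zero).zero
  equilibrium := (BinaryTree.isFlow_flow hf.sum_eq_zero).equilibrium

theorem flow_ne_zero (hf : IsVertexSystem p f) (T : BinaryTree E I) : T.flow f ≠ 0 := by
  obtain ⟨a, b, hab⟩ := T.exists_adj
  intro h
  exact BinaryTree.flow_ne_zero hf.nonParallelizable hab (congrFun (congrFun h a) b)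

theorem stronglyGeneric_scheme (hf : IsVertexSystem p f) (T : BinaryTree E I) :
    (hf.scheme T).StronglyGeneric := by
  refine ⟨fun a b c h h' hac he => ?_, T.flow f, hf.isEquilibrium_scheme T, hf.flow_ne_zero T, ?_⟩
  · refine BinaryTree.ker_flow_ne (T := T) hf.nonParallelizable h h' hac ?_
    rw [← hf.scheme_line T h, ← hf.scheme_line T h', he]
  · rw [BinaryTree.leafForce_flow hf.sum_eq_zero]
    exact hf.nonParallelizable

/-- The surgered flow on `T'` has the leaf forces `f`, and a flow is determined by these, so it is
the flow defining the scheme on `T'`. -/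
theorem isSurgery_scheme (hf : IsVertexSystem p f) {T T' : BinaryTree E I}
    {v₁ v₂ v₃ v₄ v₅ v₆ : E ⊕ I} (h : T.IsSurgeryAt T' v₁ v₂ v₃ v₄ v₅ v₆) :
    ResolutionScheme.IsSurgery (hf.scheme T) (hf.scheme T') := by
  have hflow := BinaryTree.isFlow_flow (T := T) hf.sum_eq_zero
  have hflow' := BinaryTree.isFlow_flow (T := T') hf.sum_eq_zero
  have heq : T'.flow f = BinaryTree.surgeryFlow (T.flow f) v₁ v₂ v₄ v₅ :=
    hflow'.eq_of_leafForce_eq (h.isFlow hflow) (by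
      rw [h.leafForce_surgeryFlow hflow, BinaryTree.leafForce_flow hf.sum_eq_zero,
        BinaryTree.leafForce_flow hf.sum_eq_zero])
  refine ⟨hf.stronglyGeneric_scheme T, v₁, v₂, v₃, v₄, v₅, v₆,
    { nodup := h.nodup, adj₁₂ := h.adj₁₂, adj₁₃ := h.adj₁₃, adj₁₄ := h.adj₁₄, adj₂₅ := h.adj₂₅,
      adj₂₆ := h.adj₂₆, edges := h.edges, line₁₅ := ?_, line₂₄ := ?_, line_other := ?_,
      line₁₂ := ⟨T.flow f, hf.isEquilibrium_scheme T, hf.flow_ne_zero T, ?_⟩ }⟩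
  · intro h1 h2
    apply Subtype.ext
    rw [hf.scheme_line T h1, hf.scheme_line T' h2, heq, h.surgeryFlow₁₅ hflow]
  · intro h1 h2
    apply Subtype.ext
    rw [hf.scheme_line T h1, hf.scheme_line T' h2, heq, h.surgeryFlow₂₄ hflow]
  · rintro ⟨a, b⟩ h1 h2 hne
    apply Subtype.ext
    refine (hf.scheme_line T' h2).trans (Eq.trans ?_ (hf.scheme_line T h1).symm)
    rw [heq, h.surgeryFlow_of_adj _ h1 h2 hne]
  · intro h2
    have h3 := isLineOfForce_ker
      (BinaryTree.flow_ne_zero (T := T') hf.nonParallelizable (show T'.graph.Adj v₁ v₂ from h2))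
    have h4 : T.flow f v₁ v₃ + T.flow f v₂ v₅ = - T'.flow f v₁ v₂ := by
      rw [heq, h.surgeryFlow₁₂ hflow, neg_neg]
    rw [isLineOfForce_iff, hf.scheme_line T' h2, h4, map_neg, LinearMap.ker_neg, neg_ne_zero]
    exact isLineOfForce_iff.1 h3

/-- A surgery at the first interior edge of the path from `j` to `k` shortens the path by one; at
length two the leaves share a vertex. -/
theorem exists_equivalent_of_path (hf : IsVertexSystem p f) {j k : E} (n : ℕ) (T : BinaryTree E I)
    (w : T.graph.Walk (Sum.inl j) (Sum.inl k)) (hw : w.IsPath) (hn : w.length = n + 2) :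
    ∃ T' : BinaryTree E I, (hf.scheme T).Equivalent (hf.scheme T') ∧
      ∃ v, T'.graph.Adj (Sum.inl j) v ∧ T'.graph.Adj (Sum.inl k) v := by
  induction n generalizing T with
  | zero =>
    rcases w with _ | @⟨_, v, _, h₁, _ | @⟨_, _, _, h₂, _ | ⟨h₃, q⟩⟩⟩
    · simp at hn
    · simp at hn
    · exact ⟨T, Relation.ReflTransGen.refl, v, h₁, h₂.symm⟩
    · simp at hn
  | succ n ih =>
    rcases w with _ | @⟨_, v₁, _, h₁, _ | @⟨_, v₂, _, h₂, _ | @⟨_, v₅, _, h₃, q⟩⟩⟩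
    · simp at hn
    · simp at hn
    · simp at hn
    · simp only [SimpleGraph.Walk.cons_isPath_iff, SimpleGraph.Walk.support_cons,
        List.mem_cons, not_or] at hw
      obtain ⟨⟨⟨hq, hv₂q⟩, hv₁₂, hv₁q⟩, hjv₁, hjv₂, hjq⟩ := hw
      have hv₅q := q.start_mem_support
      obtain ⟨v₄, hj4, h24, h4⟩ := T.exists_third_adj h₁.symm h₂ hjv₂
      obtain ⟨v₆, h16, h56, h6⟩ := T.exists_third_adj h₂.symm h₃ (fun h => hv₁q (h ▸ hv₅q))
      have a4 : T.graph.Adj v₁ v₄ := (h4 v₄).2 (by simp)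
      have a6 : T.graph.Adj v₂ v₆ := (h6 v₆).2 (by simp)
      have tri : ∀ {x y}, T.graph.Adj v₁ x → T.graph.Adj v₂ y → x ≠ y := by
        rintro x y hx hy rfl
        exact not_adj_of_adj_of_adj T.isTree h₂ hx hy
      have hnodup : [v₁, v₂, Sum.inl j, v₄, v₅, v₆].Nodup := by
        simp only [List.nodup_cons, List.mem_cons, List.not_mem_nil, or_false, not_or,
          not_false_eq_true, List.nodup_nil, and_true]
        have e1 : v₁ ≠ v₅ := fun h => hv₁q (h ▸ hv₅q)
        exact ⟨⟨hv₁₂, h₁.ne', a4.ne, e1, h16⟩, ⟨Ne.symm hjv₂, h24, h₃.ne, a6.ne⟩,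
          ⟨hj4, tri h₁.symm h₃, tri h₁.symm a6⟩, ⟨tri a4 h₃, tri a4 a6⟩, h56⟩
      -- Here `v₃` is the leaf `j` and `v₅` is the next vertex on the path. Afterwards `v₁` is
      -- adjacent to `v₅`, so `v₂` is skipped; the rest of the path avoids `v₁` and `v₂` and
      -- survives.
      obtain ⟨T', hT'⟩ := T.exists_isSurgeryAt hnodup h₂ h₁.symm a4 h₃ a6
      have hj' : T'.graph.Adj (Sum.inl j) v₁ := by
        rw [hT'.adj_iff]
        refine Or.inl ⟨h₁, fun h => ?_, fun h => ?_⟩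
        · rcases Sym2.eq_iff.1 h with h | h
          · exact hjv₁ h.1
          · exact hj4 h.1
        · rcases Sym2.eq_iff.1 h with h | h
          · exact hjv₂ h.1
          · exact hv₁₂ h.2
      have hedge : ∀ e ∈ q.edges, e ∈ T'.graph.edgeSet := by
        rintro ⟨a, b⟩ he
        have ha := q.fst_mem_support_of_mem_edges he
        have hb := q.snd_mem_support_of_mem_edges he
        refine (hT'.adj_iff a b).2 (Or.inl ⟨q.adj_of_mem_edges he, fun h => ?_, fun h => ?_⟩)
        · rcases Sym2.eq_iff.1 h with ⟨rfl, -⟩ | ⟨-, rfl⟩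
          · exact hv₁q ha
          · exact hv₁q hb
        · rcases Sym2.eq_iff.1 h with ⟨rfl, -⟩ | ⟨-, rfl⟩
          · exact hv₂q ha
          · exact hv₂q hb
      obtain ⟨T'', hT'', h⟩ := ih T' (.cons hj' (.cons hT'.adj₁₅' (q.transfer _ hedge))) (by
          simp only [SimpleGraph.Walk.cons_isPath_iff, SimpleGraph.Walk.support_cons,
            List.mem_cons, not_or, SimpleGraph.Walk.support_transfer]
          exact ⟨⟨hq.transfer hedge, hv₁q⟩, hjv₁, hjq⟩) (by
          simp only [SimpleGraph.Walk.length_cons, SimpleGraph.Walk.length_transfer] at hn ⊢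
          omega)
      exact ⟨T'', Relation.ReflTransGen.head (hf.isSurgery_scheme hT') hT'', h⟩

theorem exists_isAssociatedFraming (hf : IsVertexSystem p f) (hE : 3 ≤ Fintype.card E)
    (T : BinaryTree E I) {j k : E} (hjk : j ≠ k) :
    ∃ ℓ : ProjLine, (hf.scheme T).IsAssociatedFraming j k ℓ ∧
      ℓ.1 = LinearMap.ker (form (f j + f k)) := by
  obtain ⟨w, hw⟩ := (T.isTree.connected.preconnected (Sum.inl j) (Sum.inl k)).exists_isPath
  have hjk' : (Sum.inl j : E ⊕ I) ≠ Sum.inl k := by simpa using hjk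
  obtain ⟨n, hn⟩ : ∃ n, w.length = n + 2 := by
    match w with
    | .nil => exact absurd rfl hjk
    | .cons h .nil =>
      -- If `j` and `k` were adjacent, the cuts `{j}` and `{k}` would be complementary, leaving no
      -- room for a third leaf.
      obtain ⟨l, hl, hl'⟩ := exists_ne_ne_of_card hE j k
      have h1 := BinaryTree.mem_cut_swap h (e := l)
      rw [BinaryTree.cut_leaf h, BinaryTree.cut_leaf h.symm] at h1
      simp [hl, hl'] at h1
    | .cons h (.cons h' q) => exact ⟨q.length, rfl⟩
  obtain ⟨T', hT', v, hj, hk⟩ := hf.exists_equivalent_of_path n T w hw hn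
  obtain ⟨u, hju, hku, hu⟩ := T'.exists_third_adj hj.symm hk.symm hjk'
  have hvu : T'.graph.Adj v u := (hu u).2 (by simp)
  refine ⟨_, ⟨_, hT', v, u, hj, hk, hju.symm, hku.symm, hvu, rfl⟩, ?_⟩
  have hflow := BinaryTree.isFlow_flow (T := T') hf.sum_eq_zero
  have h0 := hflow.add_add_eq_zero hj.symm hk.symm hvu hjk' hju hku
  rw [← hflow.leafForce_eq hj.symm, ← hflow.leafForce_eq hk.symm,
    BinaryTree.leafForce_flow hf.sum_eq_zero] at h0
  rw [hf.scheme_line T' hvu, eq_neg_of_add_eq_zero_right h0, map_neg, LinearMap.ker_neg]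

end IsVertexSystem

/-! ### Equilibrium force-loads of resolution schemes -/

namespace ResolutionScheme

variable {E I : Type*} {p : Point} {S S' : ResolutionScheme E I p}

theorem line_congr (S : ResolutionScheme E I p) {e e' : Sym2 (E ⊕ I)}
    (h : e ∈ S.tree.graph.edgeSet) (h' : e' ∈ S.tree.graph.edgeSet) (he : e = e') :
    S.line ⟨e, h⟩ = S.line ⟨e', h'⟩ := by
  subst he
  rfl

variable [Fintype E] [Fintype I] {F F' : E ⊕ I → E ⊕ I → TwoForm}

theorem IsEquilibrium.isFlow (h : S.IsEquilibrium F) : S.tree.IsFlow F :=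
  ⟨h.stress, h.zero, h.equilibrium⟩

theorem IsEquilibrium.le_ker (h : S.IsEquilibrium F) {a b : E ⊕ I}
    (hab : s(a, b) ∈ S.tree.graph.edgeSet) :
    (S.line ⟨s(a, b), hab⟩).1 ≤ LinearMap.ker (form (F a b)) :=
  (h.along a b hab).le_ker

theorem isEquilibrium_of_isFlow (h : S.tree.IsFlow F)
    (hline : ∀ a b (hab : s(a, b) ∈ S.tree.graph.edgeSet),
      (S.line ⟨s(a, b), hab⟩).1 ≤ LinearMap.ker (form (F a b))) : S.IsEquilibrium F where
  along a b hab := (actsAlong_iff (S.line _).2).2 (hline a b hab)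
  stress := h.antisymm
  zero := h.zero
  equilibrium := h.equilibrium

/-- If one of the three forces at `b` vanishes, the other two are opposite but act along distinct
lines, so they vanish too. Connectedness then spreads this over the tree. -/
theorem IsEquilibrium.eq_zero_of_adj (hS : S.WeaklyGeneric) (h : S.IsEquilibrium F)
    {a b c : E ⊕ I} (hb : S.tree.graph.Adj b a) (h0 : F b a = 0) : F b c = 0 := by
  by_cases hbc : S.tree.graph.Adj b c
  · by_cases hac : a = c
    · rw [← hac, h0]
    obtain ⟨d, had, hcd, hd⟩ := S.tree.exists_third_adj hb hbc hac
    have hbd : S.tree.graph.Adj b d := (hd d).2 (by simp)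
    have hsum := h.isFlow.add_add_eq_zero hb hbc hbd hac had hcd
    rw [h0, zero_add] at hsum
    have h1 := h.le_ker (a := b) (b := c) hbc
    have h2 := h.le_ker (a := b) (b := d) hbd
    rw [eq_neg_of_add_eq_zero_right hsum, map_neg, LinearMap.ker_neg] at h2
    refine form_eq_zero.1 (dual_eq_zero_of_ne (S.line _).2 (S.line _).2 (fun e => ?_) h1 h2)
    refine hS c b d hbc.symm hbd hcd (Eq.trans ?_ (Subtype.ext e))
    exact S.line_congr _ _ Sym2.eq_swap
  · exact h.zero _ _ hbc

theorem IsEquilibrium.eq_zero (hS : S.WeaklyGeneric) (h : S.IsEquilibrium F)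
    {a b : E ⊕ I} (hab : S.tree.graph.Adj a b) (h0 : F a b = 0) : F = 0 := by
  have key : ∀ v, ∀ y, F v y = 0 := by
    intro v
    obtain ⟨w⟩ := S.tree.isTree.connected.preconnected v a
    induction w with
    | nil => exact fun y => h.eq_zero_of_adj hS hab h0
    | cons huv _ ih =>
      intro y
      refine h.eq_zero_of_adj hS huv ?_
      rw [h.isFlow.swap, ih hab h0, neg_zero]
  ext v y : 2
  exact key v y

/-- Nonzero equilibrium force-loads of weakly generic schemes are unique up to a factor. -/
theorem IsEquilibrium.exists_smul (hS : S.WeaklyGeneric) (h : S.IsEquilibrium F) (hF : F ≠ 0)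
    (h' : S.IsEquilibrium F') : ∃ c : ℝ, ∀ a b, F' a b = c • F a b := by
  obtain ⟨a, b, hab⟩ := S.tree.exists_adj
  have hFab : F a b ≠ 0 := fun h0 => hF (h.eq_zero hS hab h0)
  obtain ⟨c, hc⟩ := exists_smul_of_le_ker (S.line _).2 hFab (h.le_ker (a := a) (b := b) hab)
    (h'.le_ker (a := a) (b := b) hab)
  -- Match the two loads on one edge; their difference is an equilibrium load vanishing there, hence
  -- everywhere.
  have hd : S.IsEquilibrium (fun a b => F' a b - c • F a b) := by
    refine isEquilibrium_of_isFlow (h'.isFlow.sub h.isFlow c) fun x y hxy z hz => ?_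
    have h1 : form (F x y) z = 0 := h.le_ker hxy hz
    have h2 : form (F' x y) z = 0 := h'.le_ker hxy hz
    rw [LinearMap.mem_ker, map_sub, map_smul, LinearMap.sub_apply, LinearMap.smul_apply, h1, h2,
      smul_zero, sub_zero]
  have hz := hd.eq_zero hS hab (by rw [hc, sub_self])
  exact ⟨c, fun x y => sub_eq_zero.1 (congrFun (congrFun hz x) y)⟩

/-- The leaf forces of equilibrium force-loads are preserved by HΦ-surgeries. -/
theorem IsSurgery.exists_isEquilibrium (h : IsSurgery S S') (hF : S.IsEquilibrium F) :
    ∃ F', S'.IsEquilibrium F' ∧ leafForce F' = leafForce F := by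
  obtain ⟨⟨hS, -⟩, v₁, v₂, v₃, v₄, v₅, v₆, h⟩ := h
  have hT : S.tree.IsSurgeryAt S'.tree v₁ v₂ v₃ v₄ v₅ v₆ :=
    ⟨h.nodup, h.adj₁₂, h.adj₁₃, h.adj₁₄, h.adj₂₅, h.adj₂₆, h.edges⟩
  have hflow := hT.isFlow hF.isFlow
  obtain ⟨F₀, hF₀, hne, hline⟩ := h.line₁₂
  -- The new line is given through some load `F₀`; proportionality transfers it to `F`. Since `F`
  -- may be zero, only an inclusion in the kernel is claimed.
  obtain ⟨c, hc⟩ := hF₀.exists_smul hS hne hF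
  refine ⟨_, isEquilibrium_of_isFlow hflow fun a b hab => ?_, hT.leafForce_surgeryFlow hF.isFlow⟩
  have hcases : ∀ x y, (∀ hxy : s(x, y) ∈ S'.tree.graph.edgeSet, (S'.line ⟨s(x, y), hxy⟩).1 ≤
      LinearMap.ker (form (BinaryTree.surgeryFlow F v₁ v₂ v₄ v₅ x y))) → s(a, b) = s(x, y) →
      (S'.line ⟨s(a, b), hab⟩).1 ≤
        LinearMap.ker (form (BinaryTree.surgeryFlow F v₁ v₂ v₄ v₅ a b)) := by
    intro x y hxy he
    rcases Sym2.eq_iff.1 he with ⟨rfl, rfl⟩ | ⟨rfl, rfl⟩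
    · exact hxy hab
    · rw [hflow.swap b a, map_neg, LinearMap.ker_neg, S'.line_congr hab (he ▸ hab) he]
      exact hxy _
  by_cases h12 : s(a, b) = s(v₁, v₂)
  · refine hcases _ _ (fun hxy => ?_) h12
    rw [hT.surgeryFlow₁₂ hF.isFlow, (isLineOfForce_iff.1 (hline hxy)).2, hc, hc, ← smul_add,
      map_neg, LinearMap.ker_neg, map_smul]
    exact LinearMap.ker_le_ker_smul _ _
  by_cases h15 : s(a, b) = s(v₁, v₅)
  · refine hcases _ _ (fun hxy => ?_) h15
    rw [hT.surgeryFlow₁₅ hF.isFlow, h.line₁₅ h.adj₂₅ hxy]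
    exact hF.le_ker _
  by_cases h24 : s(a, b) = s(v₂, v₄)
  · refine hcases _ _ (fun hxy => ?_) h24
    rw [hT.surgeryFlow₂₄ hF.isFlow, h.line₂₄ h.adj₁₄ hxy]
    exact hF.le_ker _
  have hab' : S.tree.graph.Adj a b := by
    have := (hT.adj_iff a b).1 hab
    tauto
  rw [hT.surgeryFlow_of_adj F hab' hab h12, h.line_other _ hab' hab h12]
  exact hF.le_ker _

theorem Equivalent.exists_isEquilibrium (h : S.Equivalent S') (hF : S.IsEquilibrium F) :
    ∃ F', S'.IsEquilibrium F' ∧ leafForce F' = leafForce F := by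
  induction h with
  | refl => exact ⟨F, hF, rfl⟩
  | tail _ hs ih =>
    obtain ⟨F₁, hF₁, he₁⟩ := ih
    obtain ⟨F₂, hF₂, he₂⟩ := hs.exists_isEquilibrium hF₁
    exact ⟨F₂, hF₂, he₂.trans he₁⟩

/-- Surgeries preserve leaf forces, so in any equivalent scheme equilibrium at the common vertex
puts `-(f j + f k)` on the third edge. The framing is therefore independent of the choices. -/
theorem IsAssociatedFraming.eq_ker {j k : E} {ℓ : ProjLine} (h : S.IsAssociatedFraming j k ℓ)
    (hjk : j ≠ k) (hF : S.IsEquilibrium F) (hnp : NonParallelizableSystem (leafForce F))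
    (hE : 3 ≤ Fintype.card E) :
    ℓ.1 = LinearMap.ker (form (leafForce F j + leafForce F k)) := by
  obtain ⟨S', hS', v, w, hj, hk, hwj, hwk, hvw, rfl⟩ := h
  obtain ⟨F', hF', he⟩ := hS'.exists_isEquilibrium hF
  have h0 := hF'.isFlow.add_add_eq_zero hj.symm hk.symm hvw (by simpa using hjk) hwj.symm hwk.symm
  rw [← hF'.isFlow.leafForce_eq hj.symm, ← hF'.isFlow.leafForce_eq hk.symm, he] at h0
  have h1 := hF'.le_ker hvw
  rw [eq_neg_of_add_eq_zero_right h0, map_neg, LinearMap.ker_neg] at h1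
  refine Submodule.eq_of_le_of_finrank_eq h1 ?_
  rw [(S'.line _).2, finrank_ker_dual fun h => hnp.add_ne_zero hE hjk (form_eq_zero.1 h)]

end ResolutionScheme

/-! ### Framed cycles of tensegrities -/

section Framework

variable {V : Type*} {G : SimpleGraph V}

theorem IsSimpleCycle.adj_pred {k : ℕ} {q : ZMod k → V} (hq : IsSimpleCycle G q) (t : ZMod k) :
    G.Adj (q t) (q (t - 1)) := by
  simpa using (hq.adj (t - 1)).symm

theorem IsSimpleCycle.pred_ne_succ {k : ℕ} {q : ZMod k → V} (hq : IsSimpleCycle G q)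
    (t : ZMod k) : q (t - 1) ≠ q (t + 1) := by
  intro h
  have h2 : ((2 : ℕ) : ZMod k) = 0 := by
    have := hq.injective h
    push_cast
    linear_combination -this
  rw [ZMod.natCast_eq_zero_iff] at h2
  have := Nat.le_of_dvd (by norm_num) h2
  have := hq.three_le
  omega

variable [Fintype V] [DecidableRel G.Adj] {P : V → Point}

/-- On the framing line the two cycle forces at a vertex cancel as functionals, so the outgoing one
is minus the force on the previous edge seen from its end, that is, `r` times that force seen from
its start. -/
theorem isFramedBy_of_loads {g : V → V → TwoForm} {r : V → V → ℝ}
    (hdeg : ∀ v, 3 ≤ G.degree v)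
    (hline : ∀ i j, G.Adj i j → join (P i) (P j) = LinearMap.ker (form (g i j)))
    (hnp : ∀ i, NonParallelizableSystem (fun j : G.neighborSet i => g i j))
    (hr : ∀ i j, G.Adj i j → g j i = - (r i j • g i j))
    {k : ℕ} {q : ZMod k → V} (hq : IsSimpleCycle G q) {L : ZMod k → ProjLine}
    (hL : ∀ t, (L t).1 =
      LinearMap.ker (form (g (q t) (q (t - 1)) + g (q t) (q (t + 1))))) :
    IsFramedBy (fun t => P (q t)) L (fun t => form (g (q t) (q (t + 1))))
      (fun t => r (q t) (q (t + 1))) := by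
  have hcard : ∀ v, 3 ≤ Fintype.card (G.neighborSet v) := fun v => by
    rw [SimpleGraph.card_neighborSet_eq_degree]
    exact hdeg v
  have hne : ∀ t, LinearMap.ker (form (g (q t) (q (t + 1)))) ≠ (L t).1 := fun t => by
    rw [hL, add_comm (g (q t) (q (t - 1)))]
    exact (hnp (q t)).ker_ne (hcard _) (j := ⟨_, hq.adj t⟩) (k := ⟨_, hq.adj_pred t⟩)
      (fun h => hq.pred_ne_succ t (congrArg Subtype.val h).symm)
  have hne' : ∀ t, LinearMap.ker (form (g (q t) (q (t - 1)))) ≠ (L t).1 := fun t => by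
    rw [hL]
    exact (hnp (q t)).ker_ne (hcard _) (j := ⟨_, hq.adj_pred t⟩) (k := ⟨_, hq.adj t⟩)
      (fun h => hq.pred_ne_succ t (congrArg Subtype.val h))
  constructor
  · exact fun t => hline _ _ (hq.adj t)
  · exact fun t h => (hnp (q t)).ne_zero (hcard _) ⟨_, hq.adj t⟩ (form_eq_zero.1 h)
  · intro t x hx
    have h1 : x ∈ LinearMap.ker (form (g (q t) (q (t - 1)))) := by
      rw [← hline _ _ (hq.adj_pred t)]
      exact (le_sup_left : _ ≤ join _ _) hx
    have h2 : x ∈ LinearMap.ker (form (g (q t) (q (t + 1)))) := by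
      rw [← hline _ _ (hq.adj t)]
      exact (le_sup_left : _ ≤ join _ _) hx
    rw [LinearMap.mem_ker] at h1 h2
    rw [hL, LinearMap.mem_ker, map_add, LinearMap.add_apply, h1, h2, add_zero]
  · intro t
    rw [hline _ _ (hq.adj t)]
    exact hne t
  · intro t
    have h := hne' (t + 1)
    rw [add_sub_cancel_right, ← hline _ _ (hq.adj t).symm] at h
    rwa [join, sup_comm] at h
  · intro t x hx
    rw [hL, LinearMap.mem_ker, add_sub_cancel_right, hr _ _ (hq.adj t), map_add, map_neg, map_smul,
      LinearMap.add_apply, LinearMap.neg_apply, LinearMap.smul_apply, smul_eq_mul] at hx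
    linear_combination hx

/-! ### The two implications of the theorem. -/

theorem exists_quantization_of_tensegrity (hdeg : ∀ v, 3 ≤ G.degree v) {F : V → V → TwoForm}
    (hF : IsNonParallelizableTensegrity G P F) :
    ∃ Q : Quantization G P, Q.Generic ∧ Q.Consistent := by
  have hcard : ∀ v, 3 ≤ Fintype.card (G.neighborSet v) := fun v => by
    rw [SimpleGraph.card_neighborSet_eq_degree]
    exact hdeg v
  have hline : ∀ i j, G.Adj i j → join (P i) (P j) = LinearMap.ker (form (F i j)) := fun i j h =>
    (isLineOfForce_iff.1 ((hF.along i j h).resolve_left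
      ((hF.nonParallelizable i).ne_zero (hcard i) ⟨j, h⟩))).2
  have hswap : ∀ i j, F j i = - F i j := fun i j => eq_neg_of_add_eq_zero_right (hF.stress i j)
  have hsys : ∀ i, IsVertexSystem (P i) (fun j : G.neighborSet i => F i j) := by
    intro i
    refine ⟨hF.nonParallelizable i, ?_, fun j => ?_⟩
    · rw [← hF.equilibrium i, Finset.sum_set_coe (G.neighborSet i) (f := fun j => F i j)]
      refine Finset.sum_subset (Finset.subset_univ _) fun j _ hj => hF.zero i j ?_
      simpa using hj
    · rw [← hline i j j.2]
      exact le_sup_left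
  choose I hI T using fun i => exists_binaryTree (hcard i)
  replace T := fun i => (T i).some
  let Q : Quantization G P :=
    { inner := I
      fintypeInner := hI
      tree := T
      -- The lines agree on glued leaves because `F j i = - F i j` has the same kernel as `F i j`.
      line := Quot.lift (fun e => ((hsys e.1).scheme (T e.1)).line e.2) (by
        rintro _ _ ⟨i, j, h, e, e', he, he'⟩
        apply Subtype.ext
        refine ((hsys i).scheme_line_leaf (T i) e he).trans
          (Eq.trans ?_ ((hsys j).scheme_line_leaf (T j) e' he').symm)
        simp only
        rw [hswap i j, map_neg, LinearMap.ker_neg])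
      leaf := fun i e j he => ((hsys i).scheme_line_leaf (T i) e he).trans (hline i j j.2).symm
      interior := fun i e _ => ((hsys i).scheme (T i)).mem e }
  have hQ : ∀ i, Q.scheme i = (hsys i).scheme (T i) := fun i => rfl
  refine ⟨Q, fun i => (hsys i).stronglyGeneric_scheme (T i), fun k q hq _ => ?_⟩
  choose L hL hL' using fun t => (hsys (q t)).exists_isAssociatedFraming (hcard _) (T (q t))
    (j := ⟨_, hq.adj_pred t⟩) (k := ⟨_, hq.adj t⟩)
    (fun h => hq.pred_ne_succ t (congrArg Subtype.val h))
  refine ⟨L, fun t => ⟨hq.adj_pred t, hq.adj t, hL t⟩, ?_⟩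
  exact (isFramedBy_of_loads (r := fun _ _ => 1) hdeg hline hF.nonParallelizable
    (fun i j _ => by rw [one_smul, hswap i j]) hq hL').trivialMonodromy

theorem exists_tensegrity_of_quantization (hG : G.Connected) (hdeg : ∀ v, 3 ≤ G.degree v)
    (Q : Quantization G P) (hQ : Q.Generic) (hQ' : Q.Consistent) :
    ∃ F : V → V → TwoForm, IsNonParallelizableTensegrity G P F := by
  classical
  have hcard : ∀ v, 3 ≤ Fintype.card (G.neighborSet v) := fun v => by
    rw [SimpleGraph.card_neighborSet_eq_degree]
    exact hdeg v
  choose hweak F hF hF0 hnp using hQ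
  let g : V → V → TwoForm := fun i j =>
    if h : G.Adj i j then ResolutionScheme.leafForce (F i) ⟨j, h⟩ else 0
  have hg : ∀ i (j : G.neighborSet i), g i j = ResolutionScheme.leafForce (F i) j := fun i j =>
    dif_pos j.2
  have hgnp : ∀ i, NonParallelizableSystem (fun j : G.neighborSet i => g i j) := fun i => by
    simp_rw [hg]
    exact hnp i
  have hgne : ∀ i j, G.Adj i j → g i j ≠ 0 := fun i j h => (hgnp i).ne_zero (hcard i) ⟨j, h⟩
  have hline : ∀ i j, G.Adj i j → join (P i) (P j) = LinearMap.ker (form (g i j)) := by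
    intro i j h
    obtain ⟨w, hw⟩ := (Q.tree i).exists_leaf_adj_iff ⟨j, h⟩
    have hadj : (Q.tree i).graph.Adj w (Sum.inl ⟨j, h⟩) := ((hw w).2 rfl).symm
    have h1 := (hF i).along w (Sum.inl ⟨j, h⟩) hadj
    rw [← (hF i).isFlow.leafForce_eq hadj, ← hg i ⟨j, h⟩] at h1
    have h2 := (isLineOfForce_iff.1 (h1.resolve_left (hgne i j h))).2
    rw [← h2]
    exact (Q.leaf i _ ⟨j, h⟩ (Sym2.mem_mk_right _ _)).symm
  -- Both vertex loads on an edge act along the same line, so they differ by a ratio; the sign is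
  -- chosen so that ratio `1` means opposite forces.
  have hex : ∀ i j, ∃ c : ℝ, G.Adj i j → g j i = - (c • g i j) := by
    intro i j
    by_cases h : G.Adj i j
    · have h1 := (hline i j h)
      have h2 := (hline j i h.symm)
      rw [join, sup_comm] at h2
      obtain ⟨c, hc⟩ := exists_smul_of_le_ker
        (finrank_ker_dual fun h0 => hgne i j h (form_eq_zero.1 h0)) (hgne i j h) le_rfl
        (F' := g j i) (by rw [← h1, ← h2, join])
      exact ⟨-c, fun _ => by rw [hc]; module⟩
    · exact ⟨0, fun h' => absurd h' h⟩
  choose r hr using hex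
  have hrr : ∀ i j, G.Adj i j → r i j * r j i = 1 := by
    intro i j h
    have h1 := hr i j h
    have h2 := hr j i h.symm
    rw [h1, smul_neg, neg_neg, smul_smul] at h2
    have h3 : (r j i * r i j - 1) • g i j = 0 := by
      rw [show (r j i * r i j - 1) • g i j = (r j i * r i j) • g i j - g i j by module, ← h2,
        sub_self]
    have h4 := (smul_eq_zero.1 h3).resolve_right (hgne i j h)
    linarith
  obtain ⟨c, hc0, hc⟩ := exists_potential hG hdeg hrr (by
    intro k q hq hk
    have : NeZero k := ⟨by have := hq.three_le; omega⟩
    obtain ⟨L, hL, htriv⟩ := hQ' k q hq hk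
    have hL' : ∀ t, (L t).1 =
        LinearMap.ker (form (g (q t) (q (t - 1)) + g (q t) (q (t + 1)))) := by
      intro t
      obtain ⟨h, h', hf⟩ := hL t
      rw [hf.eq_ker (fun e => hq.pred_ne_succ t (congrArg Subtype.val e)) (hF (q t)) (hnp (q t))
        (hcard _), ← hg, ← hg]
    have := (isFramedBy_of_loads hdeg hline hgnp hr hq hL').prod_eq_one htriv 0
    simpa using this)
  -- Since `c j = c i * r i j`, dividing the load at each vertex `i` by `c i` turns `g j i = -(r i j
  -- • g i j)` into exact opposition.
  refine ⟨fun i j => (c i)⁻¹ • g i j, ⟨⟨⟨fun i j h => ?_, fun i j => ?_, fun i j h => ?_⟩,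
    fun i => ?_⟩, fun i => (hgnp i).smul (inv_ne_zero (hc0 i))⟩⟩
  · have hne : (c i)⁻¹ • g i j ≠ 0 := smul_ne_zero (inv_ne_zero (hc0 i)) (hgne i j h)
    refine Or.inr (isLineOfForce_iff.2 ⟨hne, ?_⟩)
    rw [hline i j h, map_smul, LinearMap.ker_smul _ _ (inv_ne_zero (hc0 i))]
  · by_cases h : G.Adj i j
    · have hri : r i j ≠ 0 := left_ne_zero_of_mul_eq_one (hrr i j h)
      have hci := hc0 i
      rw [hr i j h, hc i j h, smul_neg, smul_smul, ← sub_eq_add_neg,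
        show ∀ (a b : ℝ) (x : TwoForm), a • x - b • x = (a - b) • x from fun a b x => by module]
      have : (c i)⁻¹ - (c i * r i j)⁻¹ * r i j = 0 := by
        field_simp
        simp
      rw [this, zero_smul]
    · have h' : ¬ G.Adj j i := fun h' => h h'.symm
      simp [g, h, h']
  · simp [g, h]
  · rw [← Finset.smul_sum]
    have h1 : ∑ j : G.neighborSet i, g i j = 0 := by
      simp_rw [hg]
      exact (hF i).isFlow.sum_leafForce
    rw [Finset.sum_set_coe (G.neighborSet i) (f := fun j => g i j)] at h1
    rw [← Finset.sum_subset (Finset.subset_univ _), h1, smul_zero]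
    intro j _ hj
    have : ¬ G.Adj i j := by simpa using hj
    simp [g, this]

end Framework

end Tensegrity

end

theorem theorem5 {V : Type*} [Fintype V] (G : SimpleGraph V) [DecidableRel G.Adj]
    (P : V → Tensegrity.Point) (hP : Tensegrity.InGeneralPosition G P) :
    (∃ F : V → V → Tensegrity.TwoForm, Tensegrity.IsNonParallelizableTensegrity G P F) ↔
      ∃ Q : Tensegrity.Quantization G P, Q.Generic ∧ Q.Consistent :=
  ⟨fun ⟨_, hF⟩ => Tensegrity.exists_quantization_of_tensegrity hP.three_le_degree hF,
    fun ⟨Q, hQ, hQ'⟩ => Tensegrity.exists_tensegrity_of_quantization hP.connected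
      hP.three_le_degree Q hQ hQ'⟩
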